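/- Let $b\ge 2$ be an integer. For $\xi\in\mathbb{R}$ let $\theta_b(\xi)\in[1,\infty]$ be the supremum of all real $\mu$ for which the inequality $$\left|\xi-\frac{p}{b^{N}}\right|\le (b^{N})^{-\mu}$$ is satisfied by infinitely many rational numbers $p/b^N$ ($p\in\mathbb{Z}$, $N\in\mathbb{Z}_{\ge 0}$), and for $\lambda\in[1,\infty]$ put $\mathscr{V}_{\lambda,(b)}=\{\xi\in\mathbb{R}:\theta_b(\xi)=\lambda\}$. Let $\dim$ and $\dim_P$ denote Hausdorff and packing dimension, and let $1/\infty=0$. Let $n\ge 1$ be an integer. (1) For every $b\ge 2$ and all $\lambda_0,\ldots,\lambda_{n-1}\in[1,\infty]$, $$n-1+\frac{1}{\max_{0\le i\le n-1}\lambda_i}\;\ge\;\dim\Big(\prod_{i=0}^{n-1}\mathscr{V}_{\lambda_i,(b)}\Big)\;\ge\;\max\Big\{n-1,\ \sum_{i=0}^{n-1}\lambda_i^{-1}\Big\}.$$ (2) If $n\ge 2$, there is a real constant $L$ depending only on $n$ such that for every $b\ge 2$ and all $\lambda_0,\ldots,\lambda_{n-1}\in[1,\infty]$ with $\lambda_i\ge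 L$ for all $i$, $$\dim\Big(\prod_{i=0}^{n-1}\mathscr{V}_{\lambda_i,(b)}\Big)>\sum_{i=0}^{n-1}\dim(\mathscr{V}_{\lambda_i,(b)}).$$ (3) For every $b\ge 2$, $$\lim_{\max\lambda_i\to\infty}\dim\Big(\prod_{i=0}^{n-1}\mathscr{V}_{\lambda_i,(b)}\Big)=n-1,\qquad \lim_{\max\lambda_i\to\infty}\dim_P\Big(\prod_{i=0}^{n-1}\mathscr{V}_{\lambda_i,(b)}\Big)=n,$$ where the limits are taken over points $(\lambda_0,\ldots,\lambda_{n-1})\in[1,\infty]^n$ whose maximum tends to infinity (points with maximum equal to $\infty$ included). -/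

import Mathlib

open scoped ENNReal NNReal Topology

noncomputable section

namespace PowerApprox

/-- The exponent `θ_b(ξ) ∈ [1, ∞]` of approximation to `ξ` by rationals whose denominator is a
power of `b`: the supremum of all `μ` such that `|ξ - p / b ^ N| ≤ (b ^ N) ^ (-μ)` is satisfied by
infinitely many rational numbers `p / b ^ N`. Solutions are counted as rational numbers, so that
`θ_b(ξ) = 1` for rational `ξ`. As `μ = 1` always qualifies, only `μ ≥ 0` need be considered. -/
def theta (b : ℕ) (ξ : ℝ) : ℝ≥0∞ :=
  ⨆ (μ : ℝ≥0) (_ : {r : ℚ | ∃ (p : ℤ) (N : ℕ), r = (p : ℚ) / (b : ℚ) ^ N ∧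
    |ξ - (r : ℝ)| ≤ ((b : ℝ) ^ N) ^ (-(μ : ℝ))}.Infinite), (μ : ℝ≥0∞)

/-- The level set `V_{lam,(b)}` of real numbers `ξ` with `θ_b(ξ) = lam`. -/
def levelSet (b : ℕ) (lam : ℝ≥0∞) : Set ℝ :=
  {ξ : ℝ | theta b ξ = lam}

/-- The Cartesian product `∏ i, V_{lam i,(b)}` as a subset of Euclidean space `ℝⁿ`. -/
def productSet (b : ℕ) {n : ℕ} (lam : Fin n → ℝ≥0∞) : Set (EuclideanSpace ℝ (Fin n)) :=
  {x | ∀ i, x i ∈ levelSet b (lam i)}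

section Packing

variable {X : Type*} [PseudoMetricSpace X]

/-- A `δ`-packing of `A`: a countable family of pairwise disjoint closed balls with centres in `A`
and positive radii at most `δ`; a ball is recorded as the pair (centre, radius). -/
def IsPacking (δ : ℝ) (A : Set X) (C : Set (X × ℝ)) : Prop :=
  C.Countable ∧ (∀ p ∈ C, p.1 ∈ A ∧ 0 < p.2 ∧ p.2 ≤ δ) ∧
    C.PairwiseDisjoint (fun p => Metric.closedBall p.1 p.2)

/-- The supremum of `∑ (2 r) ^ s` over all `δ`-packings of `A`, where `r` runs through the radii.
In a Euclidean space of positive dimension `2 r` is the diameter of the ball. -/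
def packingPreDelta (s : ℝ≥0) (δ : ℝ) (A : Set X) : ℝ≥0∞ :=
  ⨆ (C : Set (X × ℝ)) (_ : IsPacking δ A C), ∑' p : C, ENNReal.ofReal (2 * p.1.2) ^ (s : ℝ)

/-- The `s`-dimensional packing premeasure: the decreasing limit of `packingPreDelta` as
`δ → 0`. -/
def packingPre (s : ℝ≥0) (A : Set X) : ℝ≥0∞ :=
  ⨅ (δ : ℝ) (_ : 0 < δ), packingPreDelta s δ A

/-- The `s`-dimensional packing measure: the infimum of `∑ i, packingPre s (F i)` over all
countable covers `F` of `A`. -/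
def packingMeasure (s : ℝ≥0) (A : Set X) : ℝ≥0∞ :=
  ⨅ (F : ℕ → Set X) (_ : A ⊆ ⋃ i, F i), ∑' i, packingPre s (F i)

/-- The packing dimension: the supremum of the `s ≥ 0` for which the `s`-dimensional packing
measure is infinite. -/
def dimP (A : Set X) : ℝ≥0∞ :=
  ⨆ (s : ℝ≥0) (_ : packingMeasure s A = ∞), (s : ℝ≥0∞)

end Packing

/-- The filter on exponent vectors in `[1, ∞]ⁿ` describing `max_i lam i → ∞`. -/
def maxToInfinity (n : ℕ) : Filter (Fin n → ℝ≥0∞) :=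
  Filter.comap (fun lam => ⨆ i, lam i) (𝓝 ∞) ⊓ Filter.principal {lam | ∀ i, 1 ≤ lam i}

end PowerApprox

end

namespace PowerApprox

open MeasureTheory Filter Metric

/-! The lower bounds come from one random point whose coordinates all lie in the required level
sets. Coordinate `i` has base `b` digits zero on blocks `[S_k, E_k)` with `k ≡ i` mod `n`, where
`S_k = (k!)²` and `E_k` is about `λ_i S_k`. Outside the blocks a pair `0, 1` is placed at every
multiple of a large `Q`, and all other digits are independent and uniform. The blocks give
approximations of order `λ_i`; the pairs forbid better ones, since a pair `0, 1` after position `N`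
keeps the number away from every `p / b ^ N` (`ofDigits_mem_levelSet`).

A set of diameter `b ^ (-M)` has mass at most a constant times `b ^ (-F)`, where `F` is the total
number of free digits before `M` in all coordinates (`productMeasure_le`). Up to the sparse pairs,
`F` is `n M` minus the block positions. These are bounded in three ways. Blocks of different
coordinates are disjoint, so there are at most `M` of them, which gives dimension at least `n - 1`.
In coordinate `i` they have upper density at most `1 - 1/λ_i`, which gives `∑ 1/λ_i`. Just before a
new block starts they are negligible in all coordinates at once. Such scales recur for ever, and
infinitely many scales suffice for packing measure, so the packing dimension is `n` for every
exponent vector.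

The upper bound covers the points whose coordinate `j` is within `b ^ (-νN)` of some `p / b ^ N`,
for `ν < λ_j`, by about `b ^ N · b ^ (νN(n-1))` cubes of side about `b ^ (-νN)`; the resulting
series converges for exponents above `n - 1 + 1/ν` (`dimH_bounded_productSet_le`). For `n = 1` this
gives `dim V_λ ≤ 1/λ`, so the sum in (2) is at most `n / 3 < n - 1` once every `λ_i ≥ 3`. -/

/-! ### Mass distribution principles for Hausdorff and packing dimension -/

theorem le_dimH_of_measure_le {X : Type*} [MetricSpace X] [MeasurableSpace X] [BorelSpace X]
    (μ : Measure X) {q C : ℝ} {d : ℝ≥0} (hq0 : 0 < q) (hq1 : q < 1) (hC : 0 < C) (hd : 0 < d)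
    (h : ∀ᶠ M : ℕ in atTop, ∀ S : Set X, ediam S ≤ ENNReal.ofReal (q ^ M) →
      μ S ≤ ENNReal.ofReal (C * (q ^ M) ^ (d : ℝ)))
    {A : Set X} (hA : μ A ≠ 0) : (d : ℝ≥0∞) ≤ dimH A := by
  obtain ⟨M₀, hM₀⟩ := eventually_atTop.1 h
  have hd' : (0 : ℝ) < d := hd
  -- The hypothesis only concerns the scales `q ^ M`; rounding a diameter up to the next such scale
  -- costs at most a factor `q⁻¹`.
  set K : ℝ := C * (q⁻¹) ^ (d : ℝ) with hK
  have hKpos : 0 < K := by positivity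
  have hK0 : ENNReal.ofReal K ≠ 0 := by simpa using hKpos
  have key : ∀ S : Set X, ediam S ≤ ENNReal.ofReal (q ^ M₀) →
      μ S ≤ ENNReal.ofReal K * ediam S ^ (d : ℝ) := by
    intro S hS
    have hfin : ediam S ≠ ∞ := ne_top_of_le_ne_top ENNReal.ofReal_ne_top hS
    rcases eq_or_ne (ediam S) 0 with h0 | h0
    · have h1 : Tendsto (fun M : ℕ => ENNReal.ofReal (C * (q ^ M) ^ (d : ℝ))) atTop (𝓝 0) := by
        rw [← ENNReal.ofReal_zero]
        apply ENNReal.tendsto_ofReal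
        have h2 := (tendsto_pow_atTop_nhds_zero_of_lt_one hq0.le hq1).rpow_const
          (p := (d : ℝ)) (Or.inr hd'.le)
        rw [Real.zero_rpow hd'.ne'] at h2
        simpa using h2.const_mul C
      refine (ge_of_tendsto h1 ?_).trans zero_le
      filter_upwards [h] with M hM using hM S (by simp [h0])
    · set ρ := (ediam S).toReal with hρ
      have hρ0 : 0 < ρ := ENNReal.toReal_pos h0 hfin
      have hSρ : ediam S = ENNReal.ofReal ρ := (ENNReal.ofReal_toReal hfin).symm
      have hρM : ρ ≤ q ^ M₀ := by
        rw [hSρ] at hS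
        exact (ENNReal.ofReal_le_ofReal_iff (by positivity)).1 hS
      obtain ⟨N, hN1, hN2⟩ := exists_nat_pow_near_of_lt_one hρ0
        (hρM.trans (pow_le_one₀ hq0.le hq1.le)) hq0 hq1
      have hMN : M₀ ≤ N := by
        have := (pow_lt_pow_iff_right_of_lt_one₀ hq0 hq1).1 (hN1.trans_le hρM)
        omega
      refine (hM₀ N hMN S (hSρ ▸ ENNReal.ofReal_le_ofReal hN2)).trans ?_
      rw [hSρ, ENNReal.ofReal_rpow_of_pos hρ0, ← ENNReal.ofReal_mul hKpos.le]
      apply ENNReal.ofReal_le_ofReal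
      rw [hK, mul_assoc, ← Real.mul_rpow (by positivity) hρ0.le]
      have : q ^ N ≤ q⁻¹ * ρ := by
        rw [le_inv_mul_iff₀ hq0]
        rw [pow_succ'] at hN1
        exact hN1.le
      gcongr
  have h3 : (ENNReal.ofReal K)⁻¹ • μ ≤ Measure.hausdorffMeasure (d : ℝ) := by
    refine Measure.le_hausdorffMeasure _ _ (ENNReal.ofReal (q ^ M₀)) (by simp [hq0]) ?_
    intro S hS
    rw [Measure.smul_apply, smul_eq_mul]
    exact (ENNReal.inv_mul_le_iff hK0 ENNReal.ofReal_ne_top).2 (key S hS)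
  apply le_dimH_of_hausdorffMeasure_ne_zero
  intro h0
  have h4 := h3 A
  rw [h0, Measure.smul_apply, smul_eq_mul] at h4
  simp [hA] at h4

/-- By Vitali's lemma, disjoint balls of radius `r` centred in `F` can be chosen whose fivefold
enlargements, of diameter at most `10 r`, cover `F`. The chosen balls form a packing. -/
theorem measure_le_mul_packingPreDelta {X : Type*} [PseudoMetricSpace X]
    [TopologicalSpace.SeparableSpace X] [MeasurableSpace X] (μ : Measure X) {κ : ℝ≥0∞}
    {r δ : ℝ} (s : ℝ≥0) (hr : 0 < r) (hrδ : r ≤ δ) {F : Set X}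
    (h : ∀ S : Set X, ediam S ≤ ENNReal.ofReal (10 * r) → μ S ≤ κ * ENNReal.ofReal (2 * r) ^ (s : ℝ)) :
    μ F ≤ κ * packingPreDelta s δ F := by
  obtain ⟨u, huF, hdisj, hcov⟩ :=
    Vitali.exists_disjoint_subfamily_covering_enlargement_closedBall F (fun x => x) (fun _ => r) r
      (fun _ _ => le_rfl) 5 (by norm_num)
  have hcount : u.Countable := by
    apply hdisj.countable_of_nonempty_interior
    intro x _
    exact ⟨x, ball_subset_interior_closedBall (mem_ball_self hr)⟩
  have hinj : Set.InjOn (fun x : X => (x, r)) u := fun x _ y _ hxy => (Prod.ext_iff.1 hxy).1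
  have hpack : IsPacking δ F ((fun x : X => (x, r)) '' u) := by
    refine ⟨hcount.image _, ?_, ?_⟩
    · rintro _ ⟨x, hx, rfl⟩
      exact ⟨huF hx, hr, hrδ⟩
    · exact (hinj.pairwiseDisjoint_image).2 hdisj
  calc μ F ≤ μ (⋃ x ∈ u, closedBall x (5 * r)) := by
        apply measure_mono
        intro x hx
        obtain ⟨y, hy, hxy⟩ := hcov x hx
        exact Set.mem_biUnion hy (hxy (mem_closedBall_self hr.le))
    _ ≤ ∑' x : u, μ (closedBall (x : X) (5 * r)) := measure_biUnion_le μ hcount _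
    _ ≤ ∑' x : u, κ * ENNReal.ofReal (2 * r) ^ (s : ℝ) := by
        refine ENNReal.tsum_le_tsum fun x => h _ ?_
        refine ediam_le_of_forall_dist_le fun y hy z hz => ?_
        have := dist_triangle_right y z (x : X)
        rw [mem_closedBall] at hy hz
        linarith
    _ = κ * ∑' p : ((fun x : X => (x, r)) '' u), ENNReal.ofReal (2 * p.1.2) ^ (s : ℝ) := by
        rw [ENNReal.tsum_mul_left,
          tsum_image (fun p : X × ℝ => ENNReal.ofReal (2 * p.2) ^ (s : ℝ)) hinj]
    _ ≤ κ * packingPreDelta s δ F := by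
        gcongr
        exact le_iSup₂_of_le _ hpack le_rfl

/-- Unlike the Hausdorff version, this needs the mass bound only along infinitely many scales: one
packing by balls of equal radius at each good scale forces the premeasure to be infinite on every
set of positive mass, and each countable cover of `A` has such a member. -/
theorem packingMeasure_eq_top {X : Type*} [PseudoMetricSpace X]
    [TopologicalSpace.SeparableSpace X] [MeasurableSpace X] (μ : Measure X) {q C t : ℝ} {s : ℝ≥0}
    (hq0 : 0 < q) (hq1 : q < 1) (hC : 0 < C) (hst : (s : ℝ) < t)
    (h : ∃ᶠ M : ℕ in atTop, ∀ S : Set X, ediam S ≤ ENNReal.ofReal (q ^ M) →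
      μ S ≤ ENNReal.ofReal (C * (q ^ M) ^ t))
    {A : Set X} (hA : μ A ≠ 0) : packingMeasure s A = ∞ := by
  have pre : ∀ F : Set X, μ F ≠ 0 → packingPre s F = ∞ := by
    intro F hF
    simp only [packingPre, iInf_eq_top]
    intro δ hδ
    by_contra hfin
    apply hF
    have htend : Tendsto (fun M : ℕ => ENNReal.ofReal (C * 5 ^ (s : ℝ) * (q ^ M) ^ (t - s)) *
        packingPreDelta s δ F) atTop (𝓝 0) := by
      rw [← zero_mul (packingPreDelta s δ F)]
      refine ENNReal.Tendsto.mul_const ?_ (Or.inr hfin)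
      rw [← ENNReal.ofReal_zero]
      apply ENNReal.tendsto_ofReal
      have h2 := (tendsto_pow_atTop_nhds_zero_of_lt_one hq0.le hq1).rpow_const
        (p := t - s) (Or.inr (by linarith))
      rw [Real.zero_rpow (by linarith)] at h2
      simpa using h2.const_mul (C * 5 ^ (s : ℝ))
    have hev : ∀ᶠ M : ℕ in atTop, q ^ M < δ :=
      (tendsto_pow_atTop_nhds_zero_of_lt_one hq0.le hq1).eventually_lt_const hδ
    have hfreq := h.and_eventually hev
    refine le_antisymm (ge_of_tendsto_of_frequently htend (hfreq.mono ?_)) zero_le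
    rintro M ⟨hM, hMδ⟩
    have hqM : 0 < q ^ M := by positivity
    -- With this radius the enlarged balls have diameter at most `q ^ M`.
    refine measure_le_mul_packingPreDelta μ s (r := q ^ M / 10) (by positivity) (by linarith) ?_
    intro S hS
    rw [mul_div_cancel₀ _ (by norm_num)] at hS
    refine (hM S hS).trans (le_of_eq ?_)
    rw [ENNReal.ofReal_rpow_of_pos (by positivity), ← ENNReal.ofReal_mul (by positivity),
      show 2 * (q ^ M / 10) = q ^ M / 5 by ring, Real.div_rpow hqM.le (by norm_num),
      Real.rpow_sub hqM]
    congr 1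
    field_simp
  simp only [packingMeasure, iInf_eq_top]
  intro F hF
  obtain ⟨i, hi⟩ : ∃ i, μ (F i) ≠ 0 := by
    by_contra! hall
    exact hA (measure_mono_null hF (measure_iUnion_null hall))
  exact ENNReal.tsum_eq_top_of_eq_top ⟨i, pre _ hi⟩

/-- Volume comparison: the disjoint balls of a packing with `δ ≤ 1` lie in a ball of radius `k + 2`,
so the sum of the `n`-th powers of their radii is bounded, and the surplus exponent contributes `δ ^
(s - n) → 0`. -/
theorem packingPre_ball_eq_zero {E : Type*} [NormedAddCommGroup E] [NormedSpace ℝ E]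
    [FiniteDimensional ℝ E] [Nontrivial E] {s : ℝ≥0} (hs : (Module.finrank ℝ E : ℝ) < s)
    {k : ℝ} : packingPre s (ball (0 : E) k) = 0 := by
  let _ : MeasurableSpace E := borel E
  have _ : BorelSpace E := ⟨rfl⟩
  set μ : Measure E := Measure.addHaar
  set n := Module.finrank ℝ E
  set V := μ (ball (0 : E) 1) with hV
  have hV0 : V ≠ 0 := (measure_ball_pos μ _ one_pos).ne'
  have hVt : V ≠ ∞ := measure_ball_lt_top.ne
  set W := μ (ball (0 : E) (k + 2))
  have hWt : W ≠ ∞ := measure_ball_lt_top.ne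
  have bound : ∀ δ : ℝ, 0 < δ → δ ≤ 1 → packingPreDelta s δ (ball (0 : E) k) ≤
      ENNReal.ofReal (2 ^ (s : ℝ) * δ ^ ((s : ℝ) - n)) * (W / V) := by
    intro δ hδ hδ1
    refine iSup₂_le fun C hC => ?_
    obtain ⟨hcount, hmem, hdisj⟩ := hC
    calc ∑' p : C, ENNReal.ofReal (2 * p.1.2) ^ (s : ℝ)
        ≤ ∑' p : C, ENNReal.ofReal (2 ^ (s : ℝ) * δ ^ ((s : ℝ) - n)) *
            (μ (closedBall p.1.1 p.1.2) * V⁻¹) := by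
          refine ENNReal.tsum_le_tsum fun p => ?_
          obtain ⟨-, hr0, hrδ⟩ := hmem p p.2
          rw [Measure.addHaar_closedBall μ _ hr0.le, mul_assoc, ENNReal.mul_inv_cancel hV0 hVt,
            mul_one, ← ENNReal.ofReal_mul (by positivity),
            ENNReal.ofReal_rpow_of_pos (by positivity)]
          apply ENNReal.ofReal_le_ofReal
          rw [Real.mul_rpow (by norm_num) hr0.le, mul_assoc]
          gcongr
          calc p.1.2 ^ (s : ℝ) = p.1.2 ^ ((s : ℝ) - n) * p.1.2 ^ n := by
                rw [← Real.rpow_natCast, ← Real.rpow_add hr0]; congr 1; ring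
            _ ≤ _ := by
                gcongr
      _ = ENNReal.ofReal (2 ^ (s : ℝ) * δ ^ ((s : ℝ) - n)) *
            ((∑' p : C, μ (closedBall p.1.1 p.1.2)) * V⁻¹) := by
          rw [ENNReal.tsum_mul_left, ENNReal.tsum_mul_right]
      _ ≤ _ := by
          rw [div_eq_mul_inv]
          gcongr
          rw [← measure_biUnion hcount hdisj (fun p _ => isClosed_closedBall.measurableSet)]
          apply measure_mono
          intro x hx
          obtain ⟨p, hp, hxp⟩ := Set.mem_iUnion₂.1 hx
          obtain ⟨h1, h2, h3⟩ := hmem p hp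
          rw [mem_ball] at h1 ⊢
          rw [mem_closedBall] at hxp
          have := dist_triangle x p.1 0
          linarith
  have htend : Tendsto (fun δ : ℝ => ENNReal.ofReal (2 ^ (s : ℝ) * δ ^ ((s : ℝ) - n)) * (W / V))
      (𝓝[>] 0) (𝓝 0) := by
    rw [← zero_mul (W / V)]
    refine ENNReal.Tendsto.mul_const ?_ (Or.inr (ENNReal.div_ne_top hWt hV0))
    rw [← ENNReal.ofReal_zero]
    apply ENNReal.tendsto_ofReal
    have h2 := (tendsto_id.mono_left (nhdsWithin_le_nhds (s := Set.Ioi (0 : ℝ)) (a := 0))).rpow_const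
        (p := (s : ℝ) - n) (Or.inr (by linarith))
    rw [Real.zero_rpow (by linarith)] at h2
    simpa using h2.const_mul ((2 : ℝ) ^ (s : ℝ))
  refine le_antisymm (ge_of_tendsto htend ?_) zero_le
  filter_upwards [Ioc_mem_nhdsGT (zero_lt_one' ℝ)] with δ hδ
  exact (iInf₂_le δ hδ.1).trans (bound δ hδ.1 hδ.2)

theorem dimP_le_finrank {E : Type*} [NormedAddCommGroup E] [NormedSpace ℝ E]
    [FiniteDimensional ℝ E] [Nontrivial E] (A : Set E) : dimP A ≤ Module.finrank ℝ E := by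
  refine iSup₂_le fun s hs => ?_
  by_contra! hlt
  have hlt' : (Module.finrank ℝ E : ℝ) < s := by exact_mod_cast hlt
  have h0 : packingMeasure s A ≤ 0 := by
    refine (iInf₂_le (fun k : ℕ => ball (0 : E) k) ?_).trans ?_
    · rw [iUnion_ball_nat]
      exact Set.subset_univ _
    · simp [packingPre_ball_eq_zero hlt']
  simp [hs] at h0

/-! ### Digit expansions and distances to `b`-adic fractions -/

/-- The integer whose base `b` expansion consists of the first `M` digits. -/
def prefixNat {b : ℕ} (d : ℕ → Fin b) : ℕ → ℕ
  | 0 => 0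
  | M + 1 => b * prefixNat d M + d M

theorem sum_ofDigitsTerm_eq {b : ℕ} (d : ℕ → Fin b) (M : ℕ) :
    ∑ i ∈ Finset.range M, Real.ofDigitsTerm d i = prefixNat d M / (b : ℝ) ^ M := by
  have hb : (b : ℝ) ≠ 0 := by exact_mod_cast (Fin.pos (d 0)).ne'
  induction M with
  | zero => simp [prefixNat]
  | succ M ih =>
    rw [Finset.sum_range_succ, ih, prefixNat, Real.ofDigitsTerm]
    push_cast
    field_simp
    ring

theorem ofDigits_eq_prefixNat_add {b : ℕ} (d : ℕ → Fin b) (M : ℕ) :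
    Real.ofDigits d = prefixNat d M / (b : ℝ) ^ M +
      ((b : ℝ) ^ M)⁻¹ * Real.ofDigits (fun i => d (i + M)) := by
  rw [Real.ofDigits_eq_sum_add_ofDigits d M, sum_ofDigitsTerm_eq]

theorem eq_of_prefixNat_eq {b : ℕ} {d d' : ℕ → Fin b} {M : ℕ}
    (h : prefixNat d M = prefixNat d' M) : ∀ m < M, d m = d' m := by
  induction M with
  | zero => simp
  | succ M ih =>
    have hb : 0 < b := Fin.pos (d 0)
    simp only [prefixNat] at h
    have h1 : (d M : ℕ) = d' M := by
      have := congrArg (· % b) h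
      simpa [Nat.mul_add_mod, Nat.mod_eq_of_lt] using this
    have h2 : prefixNat d M = prefixNat d' M := by
      rw [h1] at h
      exact Nat.eq_of_mul_eq_mul_left hb (Nat.add_right_cancel h)
    intro m hm
    rcases Nat.lt_succ_iff_lt_or_eq.1 hm with hm | rfl
    · exact ih h2 m hm
    · exact Fin.ext h1

theorem abs_ofDigits_sub_le_of_zeros {b : ℕ} {d : ℕ → Fin b} {N E : ℕ} (hNE : N ≤ E)
    (h : ∀ m, N ≤ m → m < E → (d m : ℕ) = 0) :
    |Real.ofDigits d - prefixNat d N / (b : ℝ) ^ N| ≤ ((b : ℝ) ^ E)⁻¹ := by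
  rw [← sum_ofDigitsTerm_eq, Real.ofDigits_eq_sum_add_ofDigits d E,
    ← Finset.sum_range_add_sum_Ico _ hNE, Finset.sum_eq_zero (s := Finset.Ico N E)]
  · rw [add_zero, add_sub_cancel_left, abs_of_nonneg
      (mul_nonneg (by positivity) (Real.ofDigits_nonneg _))]
    exact mul_le_of_le_one_right (by positivity) (Real.ofDigits_le_one _)
  · intro m hm
    rw [Finset.mem_Ico] at hm
    simp [Real.ofDigitsTerm, h m hm.1 hm.2]

/-- After multiplication by `b ^ m` the fraction becomes an integer, while the fractional part of
the number lies in `[1 / b², 2 / b²]`. Since `b² ≥ 3`, this is at distance at least `1 / b²` from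
all integers. -/
theorem le_abs_ofDigits_sub_of_marker {b : ℕ} (hb : 2 ≤ b) {d : ℕ → Fin b} {m N : ℕ}
    (h0 : (d m : ℕ) = 0) (h1 : (d (m + 1) : ℕ) = 1) (hN : N ≤ m) (p : ℤ) :
    ((b : ℝ) ^ (m + 2))⁻¹ ≤ |Real.ofDigits d - p / (b : ℝ) ^ N| := by
  have hb' : (2 : ℝ) ≤ b := by exact_mod_cast hb
  have hb0 : (0 : ℝ) < b := by linarith
  set y' := Real.ofDigits (fun i => d (i + (m + 2)))
  have hy0 : 0 ≤ y' := Real.ofDigits_nonneg _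
  have hy1 : y' ≤ 1 := Real.ofDigits_le_one _
  obtain ⟨k, rfl⟩ := Nat.exists_eq_add_of_le hN
  set z : ℤ := (prefixNat d (N + k) : ℤ) - p * (b : ℤ) ^ k with hz
  have hx : Real.ofDigits d - p / (b : ℝ) ^ N =
      ((b : ℝ) ^ (N + k + 2))⁻¹ * (b ^ 2 * z + (1 + y')) := by
    rw [ofDigits_eq_prefixNat_add d (N + k + 2)]
    simp only [prefixNat, h0, h1, hz]
    push_cast
    simp only [pow_add]
    field_simp
    ring
  rw [hx, abs_mul, abs_of_pos (show 0 < ((b : ℝ) ^ (N + k + 2))⁻¹ by positivity)]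
  refine le_mul_of_one_le_right (by positivity) ?_
  rcases le_or_gt 0 z with h | h
  · have : (0 : ℝ) ≤ z := by exact_mod_cast h
    rw [abs_of_nonneg (by positivity)]
    nlinarith [mul_nonneg (sq_nonneg (b : ℝ)) this]
  · have : (z : ℝ) ≤ -1 := by exact_mod_cast Int.le_sub_one_of_lt h
    rw [le_abs]
    right
    nlinarith

/-! ### Random numbers with prescribed digits -/

/-- The prescribed digits `c`, completed by the digits of `ω` where nothing is prescribed. -/
def fillDigits {b : ℕ} (c : ℕ → Option (Fin b)) (ω : ℕ → Fin b) : ℕ → Fin b :=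
  fun m => (c m).getD (ω m)

/-- The number of digits among the first `M` that are not prescribed by `c`. -/
def freeCount {b : ℕ} (c : ℕ → Option (Fin b)) (M : ℕ) : ℕ :=
  ((Finset.range M).filter fun m => c m = none).card

/-- The distribution of a real number in `[0, 1]` with prescribed digits `c`, the other digits
being independent and uniform. -/
noncomputable def digitMeasure {b : ℕ} (c : ℕ → Option (Fin b)) : Measure ℝ :=
  (Measure.infinitePi fun _ : ℕ => ProbabilityTheory.uniformOn (Set.univ : Set (Fin b))).map
    fun ω => Real.ofDigits (fillDigits c ω)

theorem measurable_ofDigits_fillDigits {b : ℕ} (c : ℕ → Option (Fin b)) :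
    Measurable fun ω => Real.ofDigits (fillDigits c ω) := by
  refine Real.continuous_ofDigits.measurable.comp (measurable_pi_lambda _ fun m => ?_)
  unfold fillDigits
  cases c m with
  | none => exact measurable_pi_apply m
  | some a => exact measurable_const

instance {b : ℕ} [NeZero b] (c : ℕ → Option (Fin b)) : IsProbabilityMeasure (digitMeasure c) := by
  unfold digitMeasure
  have : IsProbabilityMeasure (ProbabilityTheory.uniformOn (Set.univ : Set (Fin b))) :=
    ProbabilityTheory.isProbabilityMeasure_uniformOn Set.finite_univ Set.univ_nonempty
  exact Measure.isProbabilityMeasure_map (measurable_ofDigits_fillDigits c).aemeasurable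

theorem one_le_digitMeasure {b : ℕ} [NeZero b] {c : ℕ → Option (Fin b)} {A : Set ℝ}
    (h : ∀ ω, Real.ofDigits (fillDigits c ω) ∈ A) : 1 ≤ digitMeasure c A := by
  have : IsProbabilityMeasure (ProbabilityTheory.uniformOn (Set.univ : Set (Fin b))) :=
    ProbabilityTheory.isProbabilityMeasure_uniformOn Set.finite_univ Set.univ_nonempty
  refine le_trans (le_of_eq ?_)
    (Measure.le_map_apply (measurable_ofDigits_fillDigits c).aemeasurable A)
  rw [Set.preimage_eq_univ_iff.2 (Set.range_subset_iff.2 h), measure_univ]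

/-- Points at distance at most `b ^ (-M)` have `M`-digit prefixes, read as integers, that differ by
at most 2. So the set meets at most five cylinders, and each cylinder fixes all free digits before
`M`. -/
theorem digitMeasure_le {b : ℕ} [NeZero b] (c : ℕ → Option (Fin b)) {M : ℕ} {S : Set ℝ}
    (hS : ediam S ≤ ENNReal.ofReal ((b : ℝ)⁻¹ ^ M)) :
    digitMeasure c S ≤ ENNReal.ofReal (5 * (b : ℝ)⁻¹ ^ freeCount c M) := by
  have hb0 : (0 : ℝ) < b := by exact_mod_cast NeZero.pos b
  have : IsProbabilityMeasure (ProbabilityTheory.uniformOn (Set.univ : Set (Fin b))) :=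
    ProbabilityTheory.isProbabilityMeasure_uniformOn Set.finite_univ Set.univ_nonempty
  set P := Measure.infinitePi fun _ : ℕ => ProbabilityTheory.uniformOn (Set.univ : Set (Fin b))
  have cyl : ∀ a : ℕ, P {ω | prefixNat (fillDigits c ω) M = a} ≤
      ENNReal.ofReal ((b : ℝ)⁻¹ ^ freeCount c M) := by
    intro a
    rcases Set.eq_empty_or_nonempty {ω | prefixNat (fillDigits c ω) M = a} with he | ⟨ω₀, h₀⟩
    · rw [he, measure_empty]
      exact zero_le
    · have hsub : {ω | prefixNat (fillDigits c ω) M = a} ⊆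
          Set.pi ((Finset.range M).filter fun m => c m = none) fun m => {ω₀ m} := by
        intro ω hω m hm
        simp only [Finset.coe_filter, Finset.mem_range, Set.mem_ofPred_eq] at hm
        have := eq_of_prefixNat_eq (hω.trans h₀.symm) m hm.1
        simpa [fillDigits, hm.2] using this
      refine (measure_mono hsub).trans (le_of_eq ?_)
      rw [Measure.infinitePi_pi _ fun _ _ => MeasurableSet.singleton _]
      simp only [ProbabilityTheory.uniformOn_univ, Measure.count_singleton, Finset.prod_const,
        Fintype.card_fin, freeCount]
      rw [ENNReal.ofReal_pow (by positivity), ENNReal.ofReal_inv_of_pos hb0, ENNReal.ofReal_natCast,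
        one_div]
  -- The set need not be measurable; its closure is, and has the same diameter.
  refine (measure_mono subset_closure).trans ?_
  rw [digitMeasure, Measure.map_apply (measurable_ofDigits_fillDigits c)
    isClosed_closure.measurableSet]
  rw [← ediam_closure] at hS
  rcases Set.eq_empty_or_nonempty
    ((fun ω => Real.ofDigits (fillDigits c ω)) ⁻¹' closure S) with he | ⟨ω₀, h₀⟩
  · rw [he, measure_empty]
    exact zero_le
  set A := prefixNat (fillDigits c ω₀) M with hA
  have hsub : (fun ω => Real.ofDigits (fillDigits c ω)) ⁻¹' closure S ⊆
      ⋃ a ∈ Finset.Icc (A - 2) (A + 2), {ω | prefixNat (fillDigits c ω) M = a} := by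
    intro ω hω
    have h1 : |Real.ofDigits (fillDigits c ω) - Real.ofDigits (fillDigits c ω₀)| ≤
        ((b : ℝ) ^ M)⁻¹ := by
      rw [← Real.dist_eq, ← inv_pow]
      have := (edist_le_ediam_of_mem (Set.mem_preimage.1 hω) (Set.mem_preimage.1 h₀)).trans hS
      rw [edist_dist] at this
      exact (ENNReal.ofReal_le_ofReal_iff (by positivity)).1 this
    rw [ofDigits_eq_prefixNat_add _ M, ofDigits_eq_prefixNat_add (fillDigits c ω₀) M, ← hA] at h1
    set y := Real.ofDigits fun i => fillDigits c ω (i + M)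
    set y₀ := Real.ofDigits fun i => fillDigits c ω₀ (i + M)
    have hy0 : 0 ≤ y := Real.ofDigits_nonneg _
    have hy1 : y ≤ 1 := Real.ofDigits_le_one _
    have hy0' : 0 ≤ y₀ := Real.ofDigits_nonneg _
    have hy1' : y₀ ≤ 1 := Real.ofDigits_le_one _
    set B := prefixNat (fillDigits c ω) M with hB
    have hp : 0 < ((b : ℝ) ^ M)⁻¹ := by positivity
    have h2 : (B : ℝ) / (b : ℝ) ^ M + ((b : ℝ) ^ M)⁻¹ * y -
        (A / (b : ℝ) ^ M + ((b : ℝ) ^ M)⁻¹ * y₀) = ((b : ℝ) ^ M)⁻¹ * (B - A + (y - y₀)) := by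
      ring
    rw [h2, abs_mul, abs_of_pos hp, mul_le_iff_le_one_right hp, abs_le] at h1
    have h3 : (B : ℝ) ≤ A + 2 := by linarith
    have h4 : (A : ℝ) ≤ B + 2 := by linarith
    have h3' : B ≤ A + 2 := by exact_mod_cast h3
    have h4' : A ≤ B + 2 := by exact_mod_cast h4
    simp only [Finset.mem_Icc, Set.mem_iUnion, Set.mem_ofPred_eq, exists_prop]
    exact ⟨B, ⟨by omega, by omega⟩, rfl⟩
  calc P ((fun ω => Real.ofDigits (fillDigits c ω)) ⁻¹' closure S)
      ≤ ∑ a ∈ Finset.Icc (A - 2) (A + 2), P {ω | prefixNat (fillDigits c ω) M = a} :=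
        (measure_mono hsub).trans (measure_biUnion_finset_le _ _)
    _ ≤ ∑ a ∈ Finset.Icc (A - 2) (A + 2), ENNReal.ofReal ((b : ℝ)⁻¹ ^ freeCount c M) :=
        Finset.sum_le_sum fun a _ => cyl a
    _ ≤ ENNReal.ofReal (5 * (b : ℝ)⁻¹ ^ freeCount c M) := by
        rw [Finset.sum_const, nsmul_eq_mul, ENNReal.ofReal_mul (by norm_num)]
        gcongr
        rw [show ENNReal.ofReal 5 = ((5 : ℕ) : ℝ≥0∞) by simp]
        norm_cast
        simp only [Nat.card_Icc]
        omega

/-! ### Reading the exponent off the digits -/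

theorem finite_rat_near (b : ℕ) (ξ : ℝ) (N : ℕ) :
    {r : ℚ | ∃ p : ℤ, r = (p : ℚ) / (b : ℚ) ^ N ∧ |ξ - (r : ℝ)| ≤ 1}.Finite := by
  rcases Nat.eq_zero_or_pos (b ^ N) with h0 | hpos
  · refine (Set.finite_singleton (0 : ℚ)).subset ?_
    rintro r ⟨p, hp, -⟩
    have : (b : ℚ) ^ N = 0 := by exact_mod_cast h0
    simpa [this] using hp
  have hpos' : (0 : ℝ) < (b : ℝ) ^ N := by exact_mod_cast hpos
  refine ((Set.finite_Icc ⌊(ξ - 1) * (b : ℝ) ^ N⌋ ⌈(ξ + 1) * (b : ℝ) ^ N⌉).image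
    fun p : ℤ => (p : ℚ) / (b : ℚ) ^ N).subset ?_
  rintro r ⟨p, rfl, hp⟩
  refine ⟨p, ?_, rfl⟩
  push_cast at hp
  rw [abs_le] at hp
  have h1 : (ξ - 1) * (b : ℝ) ^ N ≤ p := by
    rw [← le_div_iff₀ hpos']
    linarith
  have h2 : (p : ℝ) ≤ (ξ + 1) * (b : ℝ) ^ N := by
    rw [← div_le_iff₀ hpos']
    linarith
  exact ⟨by exact_mod_cast (Int.floor_le _).trans h1, by exact_mod_cast h2.trans (Int.le_ceil _)⟩

theorem pow_rpow_neg_le_one {b : ℕ} (hb : 1 ≤ b) (N : ℕ) (μ : ℝ≥0) :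
    ((b : ℝ) ^ N) ^ (-(μ : ℝ)) ≤ 1 := by
  refine Real.rpow_le_one_of_one_le_of_nonpos (one_le_pow₀ (by exact_mod_cast hb)) ?_
  simp

/-- Infinitely many approximations force arbitrarily large denominators. -/
theorem exists_approx_of_infinite {b : ℕ} (hb : 1 ≤ b) {ξ : ℝ} {μ : ℝ≥0}
    (h : {r : ℚ | ∃ (p : ℤ) (N : ℕ), r = (p : ℚ) / (b : ℚ) ^ N ∧
      |ξ - (r : ℝ)| ≤ ((b : ℝ) ^ N) ^ (-(μ : ℝ))}.Infinite) (N₀ : ℕ) :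
    ∃ N, N₀ ≤ N ∧ ∃ p : ℤ, |ξ - p / (b : ℝ) ^ N| ≤ ((b : ℝ) ^ N) ^ (-(μ : ℝ)) := by
  by_contra! hcon
  refine h (((Set.finite_Iio N₀).biUnion fun N _ => finite_rat_near b ξ N).subset ?_)
  rintro r ⟨p, N, rfl, hr⟩
  have hN : N < N₀ := by
    by_contra! hN
    have := hcon N hN p
    push_cast at hr
    linarith
  exact Set.mem_biUnion (Set.mem_Iio.2 hN) ⟨p, rfl, hr.trans (pow_rpow_neg_le_one hb N μ)⟩

theorem theta_ofDigits_le {b : ℕ} (hb : 2 ≤ b) {d : ℕ → Fin b} {lam : ℝ≥0∞}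
    (h : ∀ ν : ℝ≥0, lam < ν → ∀ᶠ N : ℕ in atTop, ∃ m, N ≤ m ∧ (d m : ℕ) = 0 ∧
      (d (m + 1) : ℕ) = 1 ∧ (m + 2 : ℝ) < ν * N) :
    theta b (Real.ofDigits d) ≤ lam := by
  refine iSup₂_le fun ν hν => ?_
  by_contra! hlt
  obtain ⟨N₀, hN₀⟩ := eventually_atTop.1 (h ν hlt)
  obtain ⟨N, hN, p, hp⟩ := exists_approx_of_infinite (by omega) hν N₀
  obtain ⟨m, hm, h0, h1, hlt'⟩ := hN₀ N hN
  have h2 := (le_abs_ofDigits_sub_of_marker hb h0 h1 hm p).trans hp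
  have hb1 : (1 : ℝ) < b := by exact_mod_cast hb
  rw [← Real.rpow_natCast, ← Real.rpow_natCast, ← Real.rpow_mul (by positivity),
    ← Real.rpow_neg (by positivity), Real.rpow_le_rpow_left_iff hb1] at h2
  push_cast at h2
  nlinarith

/-- Long runs of zeros might all yield the same rational. The markers exclude this: they show that
the number is not a `b`-adic fraction, so it has positive distance `δ` from any finite set of
solutions, and a run starting far enough out gives a solution closer than `δ`. -/
theorem le_theta_ofDigits {b : ℕ} (hb : 2 ≤ b) {d : ℕ → Fin b} {lam : ℝ≥0∞}
    (hmark : ∀ N, ∃ m, N ≤ m ∧ (d m : ℕ) = 0 ∧ (d (m + 1) : ℕ) = 1)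
    (h : ∀ ν : ℝ≥0, ν < lam → ∃ᶠ N : ℕ in atTop, ∃ E : ℕ, N ≤ E ∧ ν * N ≤ (E : ℝ) ∧
      ∀ m, N ≤ m → m < E → (d m : ℕ) = 0) :
    lam ≤ theta b (Real.ofDigits d) := by
  have hb1 : (1 : ℝ) < b := by exact_mod_cast hb
  have hb0 : (0 : ℝ) < b := by linarith
  refine ENNReal.le_of_forall_nnreal_lt fun ν hν => le_iSup₂_of_le ν ?_ le_rfl
  intro hfin
  have hfin' := hfin.image fun r : ℚ => (r : ℝ)
  have hnot : Real.ofDigits d ∉ (fun r : ℚ => (r : ℝ)) '' {r : ℚ | ∃ (p : ℤ) (N : ℕ),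
      r = (p : ℚ) / (b : ℚ) ^ N ∧
      |Real.ofDigits d - (r : ℝ)| ≤ ((b : ℝ) ^ N) ^ (-(ν : ℝ))} := by
    rintro ⟨_, ⟨p, N, rfl, -⟩, hr⟩
    obtain ⟨m, hm, h0, h1⟩ := hmark N
    have := le_abs_ofDigits_sub_of_marker hb h0 h1 hm p
    push_cast at hr
    rw [← hr, sub_self, abs_zero] at this
    have : 0 < ((b : ℝ) ^ (m + 2))⁻¹ := by positivity
    linarith
  obtain ⟨δ, hδ, hball⟩ := Metric.isOpen_iff.1 hfin'.isClosed.isOpen_compl _ hnot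
  have hev : ∀ᶠ N : ℕ in atTop, (b : ℝ)⁻¹ ^ N < δ :=
    (tendsto_pow_atTop_nhds_zero_of_lt_one (by positivity)
      (inv_lt_one_of_one_lt₀ hb1)).eventually_lt_const hδ
  obtain ⟨N, ⟨E, hNE, hE, hz⟩, hN⟩ := ((h ν hν).and_eventually hev).exists
  have happ := abs_ofDigits_sub_le_of_zeros hNE hz
  refine hball (a := ((prefixNat d N : ℝ) / (b : ℝ) ^ N)) ?_ ?_
  · rw [mem_ball, dist_comm, Real.dist_eq]
    refine happ.trans_lt (lt_of_le_of_lt ?_ hN)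
    rw [inv_pow]
    gcongr
    exact hb1.le
  · refine ⟨(prefixNat d N : ℚ) / (b : ℚ) ^ N, ⟨prefixNat d N, N, by simp, ?_⟩, by simp⟩
    push_cast
    refine happ.trans ?_
    rw [← Real.rpow_natCast, ← Real.rpow_natCast, ← Real.rpow_mul (by positivity),
      ← Real.rpow_neg (by positivity), Real.rpow_le_rpow_left_iff hb1]
    nlinarith

/-! ### The blocks of zeros and the markers -/

section

/-- The position at which the `k`-th block of zeros begins. -/
def blockStart (k : ℕ) : ℕ := k.factorial ^ 2

theorem blockStart_succ (k : ℕ) : blockStart (k + 1) = (k + 1) * ((k + 1) * blockStart k) := by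
  simp only [blockStart, Nat.factorial_succ]
  ring

theorem blockStart_mono : Monotone blockStart := fun _ _ h =>
  Nat.pow_le_pow_left (Nat.factorial_le h) 2

theorem le_blockStart (k : ℕ) : k ≤ blockStart k :=
  (Nat.self_le_factorial k).trans (Nat.le_self_pow two_ne_zero _)

theorem toReal_inv_le_one {x : ℝ≥0∞} (hx : 1 ≤ x) : x⁻¹.toReal ≤ 1 := by
  rw [← ENNReal.toReal_one]
  exact ENNReal.toReal_mono ENNReal.one_ne_top (ENNReal.inv_le_one.2 hx)

variable {n : ℕ} [NeZero n]

/-- The position just after the `k`-th block of zeros, which belongs to the coordinate `k` modulo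
`n`. -/
noncomputable def blockEnd (lam : Fin n → ℝ≥0∞) (k : ℕ) : ℕ :=
  ⌈(min (lam (Fin.ofNat n k)) (k + 1)).toReal * blockStart k⌉₊

section

variable {lam : Fin n → ℝ≥0∞}

theorem min_exponent_ne_top (k : ℕ) : min (lam (Fin.ofNat n k)) ((k : ℝ≥0∞) + 1) ≠ ∞ :=
  ne_top_of_le_ne_top (by simp) (min_le_right _ _)

theorem blockStart_le_blockEnd (hlam : ∀ i, 1 ≤ lam i) (k : ℕ) :
    blockStart k ≤ blockEnd lam k := by
  have h1 : 1 ≤ (min (lam (Fin.ofNat n k)) ((k : ℝ≥0∞) + 1)).toReal := by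
    rw [← ENNReal.toReal_one]
    exact ENNReal.toReal_mono (min_exponent_ne_top k) (le_min (hlam _) (by simp))
  have h2 : (blockStart k : ℝ) ≤ blockEnd lam k :=
    (le_mul_of_one_le_left (by positivity) h1).trans (Nat.le_ceil _)
  exact_mod_cast h2

theorem blockEnd_le (k : ℕ) : blockEnd lam k ≤ (k + 1) * blockStart k := by
  apply Nat.ceil_le.2
  push_cast
  gcongr
  have := ENNReal.toReal_mono (b := (k : ℝ≥0∞) + 1) (by simp)
    (min_le_right (lam (Fin.ofNat n k)) ((k : ℝ≥0∞) + 1))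
  rwa [show ((k : ℝ≥0∞) + 1).toReal = k + 1 by
    rw [ENNReal.toReal_add (by simp) (by simp)]; simp] at this

/-- The separation of the blocks: `S_{k+1} = (k+1)² S_k`, and the cap `k + 1` on the exponent leaves
one factor `k + 1` unused, even when the exponent is infinite. Everything before the end of block
`k` is thus negligible at the scale `S_{k+1}`. -/
theorem succ_mul_blockEnd_le (k : ℕ) : (k + 1) * blockEnd lam k ≤ blockStart (k + 1) := by
  rw [blockStart_succ]
  exact Nat.mul_le_mul_left _ (blockEnd_le k)

theorem blockEnd_le_blockStart_of_lt {j k : ℕ} (h : j < k) : blockEnd lam j ≤ blockStart k :=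
  ((Nat.le_mul_of_pos_left _ j.succ_pos).trans (succ_mul_blockEnd_le j)).trans (blockStart_mono h)

theorem mul_blockStart_le_blockEnd {k : ℕ} {ν : ℝ≥0} (h : (ν : ℝ≥0∞) ≤ lam (Fin.ofNat n k))
    (hk : ν ≤ k + 1) : (ν : ℝ) * blockStart k ≤ blockEnd lam k := by
  refine le_trans ?_ (Nat.le_ceil _)
  gcongr
  rw [← ENNReal.coe_toReal]
  exact ENNReal.toReal_mono (min_exponent_ne_top k) (le_min h (by exact_mod_cast hk))

theorem blockEnd_le_mul {k : ℕ} (h : lam (Fin.ofNat n k) ≠ ∞) :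
    (blockEnd lam k : ℝ) ≤ (lam (Fin.ofNat n k)).toReal * blockStart k + 1 := by
  refine (Nat.ceil_lt_add_one (by positivity)).le.trans ?_
  gcongr
  exact min_le_left _ _

theorem inv_mul_blockEnd_le (hlam : ∀ i, 1 ≤ lam i) (k : ℕ) :
    ((lam (Fin.ofNat n k))⁻¹).toReal * blockEnd lam k ≤ blockStart k + 1 := by
  rcases eq_or_ne (lam (Fin.ofNat n k)) ∞ with h | h
  · simp only [h, ENNReal.inv_top, ENNReal.toReal_zero, zero_mul]
    positivity
  · have h1 : 1 ≤ (lam (Fin.ofNat n k)).toReal := by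
      rw [← ENNReal.toReal_one]
      exact ENNReal.toReal_mono h (hlam _)
    rw [ENNReal.toReal_inv, inv_mul_le_iff₀ (by positivity)]
    nlinarith [blockEnd_le_mul h]

/-- The position `m` lies in a block of zeros of the coordinate `i`. -/
def InBlock (lam : Fin n → ℝ≥0∞) (i : Fin n) (m : ℕ) : Prop :=
  ∃ k, Fin.ofNat n k = i ∧ blockStart k ≤ m ∧ m < blockEnd lam k

theorem block_unique {j k m : ℕ} (hj : blockStart j ≤ m) (hj' : m < blockEnd lam j)
    (hk : blockStart k ≤ m) (hk' : m < blockEnd lam k) : j = k := by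
  rcases lt_trichotomy j k with h | h | h
  · have := blockEnd_le_blockStart_of_lt (lam := lam) h
    omega
  · exact h
  · have := blockEnd_le_blockStart_of_lt (lam := lam) h
    omega

theorem InBlock.eq {i i' : Fin n} {m : ℕ} (h : InBlock lam i m) (h' : InBlock lam i' m) :
    i = i' := by
  obtain ⟨j, rfl, hj, hj'⟩ := h
  obtain ⟨k, rfl, hk, hk'⟩ := h'
  rw [block_unique hj hj' hk hk']

theorem not_inBlock_of_between (hlam : ∀ i, 1 ≤ lam i) {i : Fin n} {k m : ℕ}
    (h : blockEnd lam k ≤ m) (h' : m < blockStart (k + 1)) : ¬ InBlock lam i m := by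
  rintro ⟨j, -, hj, hj'⟩
  rcases lt_trichotomy j k with hjk | rfl | hjk
  · have := blockEnd_le_blockStart_of_lt (lam := lam) hjk
    have := blockStart_le_blockEnd hlam k
    omega
  · omega
  · have := blockStart_mono (Nat.succ_le_of_lt hjk)
    simp only [Nat.succ_eq_add_one] at this
    omega

open Classical in
/-- The digits prescribed in the coordinate `i`: zeros in the blocks, and outside of the blocks
a pair `0, 1` at every multiple of `Q`. -/
noncomputable def prescribed (b : ℕ) [NeZero b] (Q : ℕ) (lam : Fin n → ℝ≥0∞) (i : Fin n) (m : ℕ) :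
    Option (Fin b) :=
  if InBlock lam i m then some 0
  else if m % Q = 0 then some 0
  else if m % Q = 1 then some (Fin.ofNat b 1)
  else none

/-- The next multiple of `Q` after `N` carries a marker unless it runs into a block of coordinate
`i`; the first multiple after that block then does. -/
theorem exists_marker {b : ℕ} [NeZero b] (hb : 2 ≤ b) {Q : ℕ} (hQ : 2 ≤ Q)
    (hlam : ∀ i, 1 ≤ lam i) (i : Fin n) (ω : ℕ → Fin b) {N : ℕ} (hN : Q + 3 ≤ N) :
    ∃ m, N ≤ m ∧ (fillDigits (prescribed b Q lam i) ω m : ℕ) = 0 ∧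
      (fillDigits (prescribed b Q lam i) ω (m + 1) : ℕ) = 1 ∧
      (m ≤ N + Q ∨ ∃ k, Fin.ofNat n k = i ∧ blockStart k ≤ N + Q + 1 ∧
        m ≤ blockEnd lam k + Q) := by
  have next : ∀ M : ℕ, ∃ m, M ≤ m ∧ m ≤ M + Q ∧ m % Q = 0 ∧ (m + 1) % Q = 1 := by
    intro M
    refine ⟨Q * (M / Q + 1), (Nat.lt_mul_div_succ M (by omega)).le, ?_, by simp, ?_⟩
    · rw [mul_add, mul_one]
      exact Nat.add_le_add_right (Nat.mul_div_le M Q) Q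
    · rw [Nat.mul_add_mod, Nat.mod_eq_of_lt hQ]
  have fill : ∀ m, m % Q = 0 → (m + 1) % Q = 1 → ¬ InBlock lam i m → ¬ InBlock lam i (m + 1) →
      (fillDigits (prescribed b Q lam i) ω m : ℕ) = 0 ∧
      (fillDigits (prescribed b Q lam i) ω (m + 1) : ℕ) = 1 := by
    intro m h0 h1 hm hm'
    simp [fillDigits, prescribed, h0, h1, hm, hm', Nat.mod_eq_of_lt hb]
  obtain ⟨m', hm1, hm2, hm3, hm4⟩ := next N
  by_cases hblock : InBlock lam i m' ∨ InBlock lam i (m' + 1)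
  · obtain ⟨k, hki, hk1, hk2⟩ : ∃ k, Fin.ofNat n k = i ∧ blockStart k ≤ m' + 1 ∧
        m' < blockEnd lam k := by
      rcases hblock with ⟨k, h1, h2, h3⟩ | ⟨k, h1, h2, h3⟩
      · exact ⟨k, h1, by omega, h3⟩
      · exact ⟨k, h1, h2, by omega⟩
    obtain ⟨m, h1, h2, h3, h4⟩ := next (blockEnd lam k)
    have hk0 : 1 ≤ k := by
      by_contra! h0
      have := blockEnd_le (lam := lam) k
      obtain rfl : k = 0 := by omega
      simp [blockStart] at this
      omega
    -- The gap behind block `k` is at least as long as `E_k > N ≥ Q + 3`, so a marker fits before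
    -- the next block.
    have hsep : 2 * blockEnd lam k ≤ blockStart (k + 1) :=
      (Nat.mul_le_mul_right _ (by omega)).trans (succ_mul_blockEnd_le k)
    obtain ⟨hf0, hf1⟩ := fill m h3 h4 (not_inBlock_of_between hlam h1 (by omega))
      (not_inBlock_of_between hlam (by omega : blockEnd lam k ≤ m + 1) (by omega))
    exact ⟨m, by omega, hf0, hf1, Or.inr ⟨k, hki, by omega, h2⟩⟩
  · push Not at hblock
    obtain ⟨hf0, hf1⟩ := fill m' hm3 hm4 hblock.1 hblock.2
    exact ⟨m', hm1, hf0, hf1, Or.inl hm2⟩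

theorem ofDigits_mem_levelSet {b : ℕ} [NeZero b] (hb : 2 ≤ b) {Q : ℕ} (hQ : 2 ≤ Q)
    (hlam : ∀ i, 1 ≤ lam i) (i : Fin n) (ω : ℕ → Fin b) :
    Real.ofDigits (fillDigits (prescribed b Q lam i) ω) ∈ levelSet b (lam i) := by
  apply le_antisymm
  · apply theta_ofDigits_le hb
    intro ν hν
    have htop : lam i ≠ ∞ := (hν.trans ENNReal.coe_lt_top).ne
    set l := (lam i).toReal with hl
    have hl1 : 1 ≤ l := by
      rw [← ENNReal.toReal_one]
      exact ENNReal.toReal_mono htop (hlam i)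
    have hlν : l < ν := by
      rw [← ENNReal.coe_toReal]
      exact (ENNReal.toReal_lt_toReal htop ENNReal.coe_ne_top).2 hν
    -- In the worse case `m ≤ E_k + Q` with `E_k ≤ l S_k + 1` and `S_k ≤ N + Q + 1`; the left side
    -- collects all terms of `m + 2` beyond `l N`.
    have hev : ∀ᶠ N : ℕ in atTop, l * (Q + 1) + Q + 3 < (ν - l) * N :=
      (tendsto_natCast_atTop_atTop.const_mul_atTop (sub_pos.2 hlν)).eventually_gt_atTop _
    filter_upwards [hev, eventually_ge_atTop (Q + 3)] with N hN hNQ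
    obtain ⟨m, hm, h0, h1, hbound⟩ := exists_marker hb hQ hlam i ω hNQ
    refine ⟨m, hm, h0, h1, ?_⟩
    have hQ0 : (0 : ℝ) ≤ Q := by positivity
    have hN0 : (0 : ℝ) ≤ N := by positivity
    rcases hbound with h | ⟨k, rfl, hk, hmk⟩
    · have h' : (m : ℝ) ≤ N + Q := by exact_mod_cast h
      nlinarith
    · have h' : (m : ℝ) ≤ blockEnd lam k + Q := by exact_mod_cast hmk
      have h'' : (blockStart k : ℝ) ≤ N + Q + 1 := by exact_mod_cast hk
      have := blockEnd_le_mul htop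
      nlinarith
  · apply le_theta_ofDigits hb
    · intro N
      obtain ⟨m, hm, h0, h1, -⟩ := exists_marker hb hQ hlam i ω (Nat.le_add_left (Q + 3) N)
      exact ⟨m, by omega, h0, h1⟩
    · intro ν hν
      rw [frequently_atTop]
      intro a
      obtain ⟨c, hc⟩ := exists_nat_ge (ν : ℝ≥0)
      -- A block of coordinate `i`, beyond `a`, and so late that the cap `k + 1` exceeds `ν`.
      set k := n * (a + c) + i with hk
      have hn : 1 ≤ n := Nat.one_le_iff_ne_zero.2 (NeZero.ne n)
      have hac : a + c ≤ k := (Nat.le_mul_of_pos_left _ hn).trans (Nat.le_add_right _ _)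
      have hki : Fin.ofNat n k = i := by
        apply Fin.ext
        simp [hk, Nat.mod_eq_of_lt]
      refine ⟨blockStart k, (by omega : a ≤ k).trans (le_blockStart k), blockEnd lam k,
        blockStart_le_blockEnd hlam k, mul_blockStart_le_blockEnd (hki ▸ hν.le) ?_, ?_⟩
      · refine hc.trans ?_
        norm_cast
        omega
      · intro m h1 h2
        have : InBlock lam i m := ⟨k, hki, h1, h2⟩
        simp [fillDigits, prescribed, this]

/-! ### Counting block positions and free digits -/

open Classical in
/-- The number of positions below `M` in the blocks of zeros of the coordinate `i`. -/
noncomputable def blockCount (lam : Fin n → ℝ≥0∞) (i : Fin n) (M : ℕ) : ℕ :=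
  ((Finset.range M).filter (InBlock lam i)).card

theorem card_filter_mod_le (Q M r : ℕ) :
    ((Finset.range M).filter fun m => m % Q = r).card ≤ M / Q + 1 := by
  rw [← Finset.card_range (M / Q + 1)]
  refine Finset.card_le_card_of_injOn (· / Q) ?_ ?_
  · intro m hm
    simp only [Finset.coe_filter, Finset.mem_range, Set.mem_ofPred_eq] at hm
    simp only [Finset.coe_range, Set.mem_Iio]
    exact Nat.lt_succ_of_le (Nat.div_le_div_right hm.1.le)
  · intro m hm m' hm' h
    simp only [Finset.coe_filter, Finset.mem_range, Set.mem_ofPred_eq] at hm hm'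
    simp only at h
    rw [← Nat.div_add_mod m Q, ← Nat.div_add_mod m' Q, h, hm.2, hm'.2]

theorem le_freeCount_add {b : ℕ} [NeZero b] (Q : ℕ) (i : Fin n) (M : ℕ) :
    M ≤ freeCount (prescribed b Q lam i) M + blockCount lam i M + 2 * (M / Q + 1) := by
  classical
  have hsub : Finset.range M ⊆
      (((Finset.range M).filter fun m => prescribed b Q lam i m = none) ∪
        (Finset.range M).filter (InBlock lam i)) ∪
      (((Finset.range M).filter fun m => m % Q = 0) ∪
        (Finset.range M).filter fun m => m % Q = 1) := by
    intro m hm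
    simp only [Finset.mem_union, Finset.mem_filter, hm, true_and]
    by_contra! h
    exact h.1.1 (by simp [prescribed, h.1.2, h.2.1, h.2.2])
  have h1 := Finset.card_le_card hsub
  have h2 := (Finset.card_union_le _ _).trans' h1
  have h3 := card_filter_mod_le Q M 0
  have h4 := card_filter_mod_le Q M 1
  have h5 := Finset.card_union_le ((Finset.range M).filter fun m => prescribed b Q lam i m = none)
    ((Finset.range M).filter (InBlock lam i))
  have h6 := Finset.card_union_le ((Finset.range M).filter fun m => m % Q = 0)
    ((Finset.range M).filter fun m => m % Q = 1)
  rw [Finset.card_range] at h2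
  unfold freeCount blockCount
  convert (show M ≤ ((Finset.range M).filter fun m => prescribed b Q lam i m = none).card +
    ((Finset.range M).filter (InBlock lam i)).card + 2 * (M / Q + 1) by omega) using 4

/-- Each position lies in a block of at most one coordinate. This is the source of the bound `n -
1`. -/
theorem sum_blockCount_le (M : ℕ) : ∑ i, blockCount lam i M ≤ M := by
  classical
  unfold blockCount
  rw [← Finset.card_biUnion]
  · refine (Finset.card_le_card ?_).trans (Finset.card_range M).le
    exact Finset.biUnion_subset.2 fun i _ => Finset.filter_subset _ _
  · intro i _ j _ hij
    rw [Function.onFun, Finset.disjoint_filter]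
    exact fun m _ hi hj => hij (hi.eq hj)

theorem blockEnd_mono (hlam : ∀ i, 1 ≤ lam i) : Monotone (blockEnd lam) := by
  intro j k h
  rcases h.lt_or_eq with h | rfl
  · exact (blockEnd_le_blockStart_of_lt h).trans (blockStart_le_blockEnd hlam k)
  · exact le_rfl

theorem blockCount_blockStart_le (hlam : ∀ i, 1 ≤ lam i) (i : Fin n) (k : ℕ) :
    blockCount lam i (blockStart (k + 1)) ≤ blockEnd lam k := by
  classical
  unfold blockCount
  refine (Finset.card_le_card ?_).trans (Finset.card_range (blockEnd lam k)).le
  intro m hm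
  simp only [Finset.mem_filter, Finset.mem_range] at hm ⊢
  obtain ⟨hm, j, -, hj, hj'⟩ := hm
  have hjk : j ≤ k := by
    by_contra! h
    have := blockStart_mono (Nat.succ_le_of_lt h)
    simp only [Nat.succ_eq_add_one] at this
    omega
  exact hj'.trans_le (blockEnd_mono hlam hjk)

/-- Blocks up to `k` fill at most `E_k ≤ M / (k + 1)` positions. Block `k + 1`, cut off at `M' = min
M E_{k+1}`, adds `M' - S_{k+1} ≤ (1 - 1/λ_i) M' + 1`, because `E_{k+1} / λ_i ≤ S_{k+1} + 1`. -/
theorem blockCount_le (hlam : ∀ i, 1 ≤ lam i) (i : Fin n) {k M : ℕ}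
    (h1 : blockStart (k + 1) ≤ M) (h2 : M ≤ blockStart (k + 2)) :
    (blockCount lam i M : ℝ) ≤ M / (k + 1) + (1 - ((lam i)⁻¹).toReal) * M + 1 := by
  classical
  have hι := toReal_inv_le_one (hlam i)
  have hι0 : 0 ≤ ((lam i)⁻¹).toReal := ENNReal.toReal_nonneg
  have hE : (blockEnd lam k : ℝ) ≤ M / (k + 1) := by
    rw [le_div_iff₀ (by positivity), mul_comm]
    exact_mod_cast (succ_mul_blockEnd_le k).trans h1
  have key : ∀ m, m < M → InBlock lam i m → m < blockEnd lam k ∨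
      (Fin.ofNat n (k + 1) = i ∧ blockStart (k + 1) ≤ m ∧ m < min M (blockEnd lam (k + 1))) := by
    rintro m hm ⟨j, hji, hj, hj'⟩
    have hjk : j ≤ k + 1 := by
      by_contra! h
      have := blockStart_mono (show k + 2 ≤ j by omega)
      omega
    rcases hjk.lt_or_eq with h | rfl
    · exact Or.inl (hj'.trans_le (blockEnd_mono hlam (Nat.lt_succ_iff.1 h)))
    · exact Or.inr ⟨hji, hj, lt_min hm hj'⟩
  by_cases hi : Fin.ofNat n (k + 1) = i
  · have hcard : blockCount lam i M ≤
        blockEnd lam k + (min M (blockEnd lam (k + 1)) - blockStart (k + 1)) := by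
      unfold blockCount
      rw [← Finset.card_range (blockEnd lam k), ← Nat.card_Ico]
      refine (Finset.card_le_card ?_).trans (Finset.card_union_le _ _)
      intro m hm
      simp only [Finset.mem_filter, Finset.mem_range, Finset.mem_union, Finset.mem_Ico] at hm ⊢
      exact (key m hm.1 hm.2).imp id And.right
    have hS := blockStart_le_blockEnd hlam (k + 1)
    have hcard' : (blockCount lam i M : ℝ) ≤
        blockEnd lam k + ((min M (blockEnd lam (k + 1)) : ℕ) - blockStart (k + 1)) := by
      rw [← Nat.cast_sub (le_min h1 hS)]
      exact_mod_cast hcard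
    have h3 := inv_mul_blockEnd_le hlam (k + 1)
    rw [hi] at h3
    have h4 : ((min M (blockEnd lam (k + 1)) : ℕ) : ℝ) ≤ M := by exact_mod_cast min_le_left _ _
    have h5 : ((min M (blockEnd lam (k + 1)) : ℕ) : ℝ) ≤ blockEnd lam (k + 1) := by
      exact_mod_cast min_le_right _ _
    nlinarith
  · have hcard : blockCount lam i M ≤ blockEnd lam k := by
      unfold blockCount
      refine (Finset.card_le_card ?_).trans (Finset.card_range (blockEnd lam k)).le
      intro m hm
      simp only [Finset.mem_filter, Finset.mem_range] at hm ⊢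
      exact (key m hm.1 hm.2).resolve_right fun h => hi h.1
    have hcard' : (blockCount lam i M : ℝ) ≤ blockEnd lam k := by exact_mod_cast hcard
    have hM0 : (0 : ℝ) ≤ M := by positivity
    nlinarith

theorem eventually_blockCount_le (hlam : ∀ i, 1 ≤ lam i) {ε : ℝ} (hε : 0 < ε) :
    ∀ᶠ M : ℕ in atTop, ∀ i,
      (blockCount lam i M : ℝ) ≤ (1 - ((lam i)⁻¹).toReal + ε) * M := by
  obtain ⟨k₀, hk₀⟩ := exists_nat_one_div_lt (half_pos hε)
  have hev : ∀ᶠ M : ℕ in atTop, 1 ≤ ε / 2 * (M : ℝ) :=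
    (tendsto_natCast_atTop_atTop.const_mul_atTop (half_pos hε)).eventually_ge_atTop _
  filter_upwards [hev, eventually_ge_atTop (blockStart (k₀ + 1))] with M hM hMk i
  have hex : ∃ j, M < blockStart j := ⟨M + 1, le_blockStart (M + 1)⟩
  classical
  have hj := Nat.find_spec hex
  have hjmin := fun m => Nat.find_min hex (m := m)
  set j := Nat.find hex
  have hjk : k₀ + 1 < j := by
    by_contra! h
    have := blockStart_mono h
    omega
  obtain ⟨k, hk⟩ := Nat.exists_eq_add_of_le' (show 2 ≤ j by omega)
  have hlow : blockStart (k + 1) ≤ M := not_lt.1 (hjmin (k + 1) (by omega))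
  have hb := blockCount_le hlam i hlow (hk ▸ hj.le)
  have hkk : (1 : ℝ) / (k + 1) ≤ ε / 2 := by
    refine le_trans ?_ hk₀.le
    have : (k₀ : ℝ) ≤ k := by exact_mod_cast (by omega : k₀ ≤ k)
    gcongr
  have hM0 : (0 : ℝ) ≤ M := by positivity
  have : (M : ℝ) / (k + 1) ≤ ε / 2 * M := by
    rw [div_eq_mul_one_div, mul_comm]
    gcongr
  linarith

/-- The good scales are the block starts, where only earlier blocks count, and these are short by
comparison. -/
theorem frequently_blockCount_le (hlam : ∀ i, 1 ≤ lam i) {ε : ℝ} (hε : 0 < ε) :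
    ∃ᶠ M : ℕ in atTop, ∀ i, (blockCount lam i M : ℝ) ≤ ε * M := by
  rw [frequently_atTop]
  intro a
  obtain ⟨k₀, hk₀⟩ := exists_nat_one_div_lt hε
  refine ⟨blockStart (a + k₀ + 1), (by omega : a ≤ a + k₀ + 1).trans (le_blockStart _), fun i => ?_⟩
  have h1 : (blockCount lam i (blockStart (a + k₀ + 1)) : ℝ) ≤ blockEnd lam (a + k₀) := by
    exact_mod_cast blockCount_blockStart_le hlam i (a + k₀)
  have h2 : (((a + k₀ : ℕ) : ℝ) + 1) * blockEnd lam (a + k₀) ≤ blockStart (a + k₀ + 1) := by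
    exact_mod_cast succ_mul_blockEnd_le (lam := lam) (a + k₀)
  have h3 : 1 ≤ ε * (((a + k₀ : ℕ) : ℝ) + 1) := by
    rw [div_lt_iff₀ (by positivity)] at hk₀
    push_cast
    have : (0 : ℝ) ≤ a := by positivity
    nlinarith
  have h4 : (0 : ℝ) ≤ blockEnd lam (a + k₀) := by positivity
  nlinarith

theorem exists_le_freeCount (b : ℕ) [NeZero b] (lam : Fin n → ℝ≥0∞) {ε : ℝ} (hε : 0 < ε) :
    ∃ Q : ℕ, 2 ≤ Q ∧ ∀ᶠ M : ℕ in atTop, ∀ i,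
      (1 - ε) * M - blockCount lam i M ≤ (freeCount (prescribed b Q lam i) M : ℝ) := by
  -- Markers occupy two positions in every `Q + 2`, a density of at most `ε / 2`; the other `ε / 2`
  -- absorbs the additive constant.
  obtain ⟨Q, hQ⟩ := exists_nat_ge (4 / ε)
  refine ⟨Q + 2, by omega, ?_⟩
  have hev : ∀ᶠ M : ℕ in atTop, 2 ≤ ε / 2 * (M : ℝ) :=
    (tendsto_natCast_atTop_atTop.const_mul_atTop (half_pos hε)).eventually_ge_atTop _
  filter_upwards [hev] with M hM i
  have h1 : (M : ℝ) ≤ freeCount (prescribed b (Q + 2) lam i) M + blockCount lam i M +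
      2 * ((M / (Q + 2) : ℕ) + 1) := by
    exact_mod_cast le_freeCount_add (b := b) (lam := lam) (Q + 2) i M
  have h2 : ((M / (Q + 2) : ℕ) : ℝ) ≤ ε / 4 * M := by
    refine Nat.cast_div_le.trans ?_
    rw [div_le_iff₀ (by positivity)]
    rw [div_le_iff₀ hε] at hQ
    push_cast
    have : (0 : ℝ) ≤ M := by positivity
    nlinarith [mul_nonneg hε.le this]
  linarith

theorem exists_sum_freeCount_ge_of_blockCount {b : ℕ} [NeZero b] {lam : Fin n → ℝ≥0∞} {ε : ℝ}
    (hε : 0 < ε) : ∃ Q : ℕ, 2 ≤ Q ∧ ∀ᶠ M : ℕ in atTop,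
      (n - ε) * M - ∑ i, (blockCount lam i M : ℝ) ≤
        ∑ i, (freeCount (prescribed b Q lam i) M : ℝ) := by
  have hn : (0 : ℝ) < n := by exact_mod_cast NeZero.pos n
  obtain ⟨Q, hQ, h⟩ := exists_le_freeCount b lam (div_pos hε hn)
  refine ⟨Q, hQ, h.mono fun M hM => ?_⟩
  have := Finset.sum_le_sum fun i (_ : i ∈ Finset.univ) => hM i
  rw [Finset.sum_sub_distrib, Finset.sum_const, Finset.card_univ, Fintype.card_fin,
    nsmul_eq_mul] at this
  refine le_trans (le_of_eq ?_) this
  field_simp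

end

end

/-! ### Lower bounds from the product measure -/

section

variable {n : ℕ} [NeZero n] {lam : Fin n → ℝ≥0∞}

/-- The product of the measures `digitMeasure` with the digits `prescribed` in each coordinate. -/
noncomputable def productMeasure (b : ℕ) [NeZero b] (Q : ℕ) (lam : Fin n → ℝ≥0∞) :
    Measure (EuclideanSpace ℝ (Fin n)) :=
  (Measure.pi fun i => digitMeasure (prescribed b Q lam i)).map (MeasurableEquiv.toLp 2 (Fin n → ℝ))

/-- Every choice of the free digits gives a point of the level set, so each factor has full measure.
Measurability of the level sets plays no role, as the product formula for boxes holds for arbitrary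
sides. -/
theorem productMeasure_productSet_ne_zero {b : ℕ} [NeZero b] (hb : 2 ≤ b) {Q : ℕ} (hQ : 2 ≤ Q)
    (hlam : ∀ i, 1 ≤ lam i) : productMeasure b Q lam (productSet b lam) ≠ 0 := by
  rw [productMeasure, MeasurableEquiv.map_apply]
  have : MeasurableEquiv.toLp 2 (Fin n → ℝ) ⁻¹' productSet b lam =
      Set.pi Set.univ fun i => levelSet b (lam i) := by
    ext x
    simp [productSet]
  rw [this, Measure.pi_pi]
  refine (zero_lt_one.trans_le (Finset.one_le_prod'' fun i => ?_)).ne'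
  exact one_le_digitMeasure (ofDigits_mem_levelSet hb hQ hlam i)

/-- Coordinate projections do not increase diameters, so the set lies in a box to whose sides
`digitMeasure_le` applies. -/
theorem productMeasure_le {b : ℕ} [NeZero b] {Q M : ℕ} {t : ℝ}
    (ht : t * M ≤ ∑ i, (freeCount (prescribed b Q lam i) M : ℝ))
    {S : Set (EuclideanSpace ℝ (Fin n))} (hS : ediam S ≤ ENNReal.ofReal ((b : ℝ)⁻¹ ^ M)) :
    productMeasure b Q lam S ≤ ENNReal.ofReal (5 ^ n * ((b : ℝ)⁻¹ ^ M) ^ t) := by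
  have hb0 : (0 : ℝ) < b := by exact_mod_cast NeZero.pos b
  have hb1 : (b : ℝ)⁻¹ ≤ 1 := inv_le_one_of_one_le₀ (by exact_mod_cast NeZero.one_le)
  rw [productMeasure, MeasurableEquiv.map_apply]
  have hsub : MeasurableEquiv.toLp 2 (Fin n → ℝ) ⁻¹' S ⊆
      Set.pi Set.univ fun i => (fun x : EuclideanSpace ℝ (Fin n) => x i) '' S :=
    fun x hx i _ => ⟨_, hx, rfl⟩
  refine (measure_mono hsub).trans ?_
  rw [Measure.pi_pi]
  have hlip : ∀ i, LipschitzWith 1 fun x : EuclideanSpace ℝ (Fin n) => x i := fun i =>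
    LipschitzWith.of_dist_le_mul fun x y => by
      simpa [Real.dist_eq, dist_eq_norm] using PiLp.norm_apply_le (x - y) i
  calc ∏ i, digitMeasure (prescribed b Q lam i) ((fun x : EuclideanSpace ℝ (Fin n) => x i) '' S)
      ≤ ∏ i, ENNReal.ofReal (5 * (b : ℝ)⁻¹ ^ freeCount (prescribed b Q lam i) M) := by
        refine Finset.prod_le_prod' fun i _ => digitMeasure_le _ (le_trans ?_ hS)
        simpa using (hlip i).ediam_image_le S
    _ = ENNReal.ofReal (5 ^ n * (b : ℝ)⁻¹ ^ (∑ i, freeCount (prescribed b Q lam i) M)) := by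
        rw [← ENNReal.ofReal_prod_of_nonneg fun i _ => by positivity, Finset.prod_mul_distrib,
          Finset.prod_const, Finset.card_univ, Fintype.card_fin, Finset.prod_pow_eq_pow_sum]
    _ ≤ _ := by
        apply ENNReal.ofReal_le_ofReal
        gcongr
        rw [← Real.rpow_natCast, ← Real.rpow_natCast, ← Real.rpow_mul (by positivity)]
        apply Real.rpow_le_rpow_of_exponent_ge (by positivity) hb1
        push_cast
        linarith

theorem inv_natCast_pos_lt_one {b : ℕ} (hb : 2 ≤ b) : 0 < (b : ℝ)⁻¹ ∧ (b : ℝ)⁻¹ < 1 := by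
  have hb1 : (1 : ℝ) < b := by exact_mod_cast hb
  exact ⟨by positivity, inv_lt_one_of_one_lt₀ hb1⟩

theorem le_dimH_productSet {b : ℕ} [NeZero b] (hb : 2 ≤ b) (hlam : ∀ i, 1 ≤ lam i) {u : ℝ≥0}
    (h : ∀ ε : ℝ, 0 < ε → ∃ Q : ℕ, 2 ≤ Q ∧ ∀ᶠ M : ℕ in atTop,
      (u - ε) * M ≤ ∑ i, (freeCount (prescribed b Q lam i) M : ℝ)) :
    (u : ℝ≥0∞) ≤ dimH (productSet b lam) := by
  refine ENNReal.le_of_forall_nnreal_lt fun d hd => ?_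
  have hd' : (d : ℝ) < u := by exact_mod_cast hd
  rcases eq_zero_or_pos d with rfl | hd0
  · simp
  obtain ⟨Q, hQ, hev⟩ := h (u - d) (sub_pos.2 hd')
  obtain ⟨hq0, hq1⟩ := inv_natCast_pos_lt_one hb
  refine le_dimH_of_measure_le (productMeasure b Q lam) hq0 hq1 (C := 5 ^ n) (by positivity) hd0 ?_
    (productMeasure_productSet_ne_zero hb hQ hlam)
  filter_upwards [hev] with M hM S hS
  rw [sub_sub_cancel] at hM
  exact productMeasure_le hM hS

theorem pred_le_dimH_productSet {b : ℕ} (hb : 2 ≤ b) (hlam : ∀ i, 1 ≤ lam i) :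
    ((n - 1 : ℕ) : ℝ≥0∞) ≤ dimH (productSet b lam) := by
  have : NeZero b := ⟨by omega⟩
  have hn : 1 ≤ n := NeZero.one_le
  refine le_dimH_productSet (u := ((n - 1 : ℕ) : ℝ≥0)) hb hlam fun ε hε => ?_
  obtain ⟨Q, hQ, h⟩ := exists_sum_freeCount_ge_of_blockCount (b := b) (lam := lam) hε
  refine ⟨Q, hQ, h.mono fun M hM => le_trans ?_ hM⟩
  have h1 : ∑ i, (blockCount lam i M : ℝ) ≤ M := by exact_mod_cast sum_blockCount_le M
  rw [NNReal.coe_natCast, Nat.cast_sub hn]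
  push_cast
  linarith

theorem sum_inv_le_dimH_productSet {b : ℕ} (hb : 2 ≤ b) (hlam : ∀ i, 1 ≤ lam i) :
    ∑ i, (lam i)⁻¹ ≤ dimH (productSet b lam) := by
  have : NeZero b := ⟨by omega⟩
  have hn : (0 : ℝ) < n := by exact_mod_cast NeZero.pos n
  have hfin : ∀ i ∈ Finset.univ, (lam i)⁻¹ ≠ ∞ := fun i _ =>
    ENNReal.inv_ne_top.2 (zero_lt_one.trans_le (hlam i)).ne'
  rw [← ENNReal.coe_toNNReal (ENNReal.sum_ne_top.2 hfin)]
  refine le_dimH_productSet hb hlam fun ε hε => ?_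
  obtain ⟨Q, hQ, h⟩ := exists_sum_freeCount_ge_of_blockCount (b := b) (lam := lam) (half_pos hε)
  refine ⟨Q, hQ, ?_⟩
  filter_upwards [h, eventually_blockCount_le hlam (div_pos (half_pos hε) hn)] with M hM hM'
  refine le_trans ?_ hM
  have h1 := Finset.sum_le_sum fun i (_ : i ∈ Finset.univ) => hM' i
  rw [← Finset.sum_mul, Finset.sum_add_distrib, Finset.sum_sub_distrib, Finset.sum_const,
    Finset.sum_const, Finset.card_univ, Fintype.card_fin, nsmul_eq_mul, nsmul_eq_mul,
    mul_div_cancel₀ _ hn.ne'] at h1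
  rw [ENNReal.coe_toNNReal_eq_toReal, ENNReal.toReal_sum hfin]
  linarith

theorem dimP_productSet {b : ℕ} (hb : 2 ≤ b) (hlam : ∀ i, 1 ≤ lam i) :
    dimP (productSet b lam) = n := by
  have : NeZero b := ⟨by omega⟩
  have hn : (0 : ℝ) < n := by exact_mod_cast NeZero.pos n
  apply le_antisymm
  · have : Nonempty (Fin n) := ⟨0⟩
    simpa using dimP_le_finrank (productSet b lam)
  · refine ENNReal.le_of_forall_nnreal_lt fun s hs => le_iSup₂_of_le s ?_ le_rfl
    have hs' : (s : ℝ) < n := by exact_mod_cast hs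
    set ε : ℝ := (n - s) / 3 with hε
    have hε0 : 0 < ε := by
      have := sub_pos.2 hs'
      positivity
    obtain ⟨Q, hQ, h⟩ := exists_sum_freeCount_ge_of_blockCount (b := b) (lam := lam) hε0
    obtain ⟨hq0, hq1⟩ := inv_natCast_pos_lt_one hb
    refine packingMeasure_eq_top (productMeasure b Q lam) hq0 hq1 (C := 5 ^ n) (t := n - 2 * ε)
      (by positivity) (by linarith) ?_ (productMeasure_productSet_ne_zero hb hQ hlam)
    refine ((frequently_blockCount_le hlam (div_pos hε0 hn)).and_eventually h).mono ?_
    rintro M ⟨hM', hM⟩ S hS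
    refine productMeasure_le (le_trans ?_ hM) hS
    have h1 := Finset.sum_le_sum fun i (_ : i ∈ Finset.univ) => hM' i
    rw [Finset.sum_const, Finset.card_univ, Fintype.card_fin, nsmul_eq_mul, ← mul_assoc,
      mul_div_cancel₀ _ hn.ne'] at h1
    linarith

end

/-! ### Upper bounds by covering with cubes -/

section

variable {n : ℕ}

theorem exists_approx_of_lt_theta {b : ℕ} (hb : 1 ≤ b) {ξ : ℝ} {ν : ℝ≥0}
    (h : (ν : ℝ≥0∞) < theta b ξ) (N₀ : ℕ) :
    ∃ N, N₀ ≤ N ∧ ∃ p : ℤ, |ξ - p / (b : ℝ) ^ N| ≤ ((b : ℝ) ^ N) ^ (-(ν : ℝ)) := by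
  simp only [theta, lt_iSup_iff] at h
  obtain ⟨μ, hμ, hνμ⟩ := h
  obtain ⟨N, hN, p, hp⟩ := exists_approx_of_infinite hb hμ N₀
  refine ⟨N, hN, p, hp.trans ?_⟩
  apply Real.rpow_le_rpow_of_exponent_le (one_le_pow₀ (by exact_mod_cast hb))
  have : (ν : ℝ) < μ := by exact_mod_cast hνμ
  linarith

/-- The cube with centre `y` and side `2 * δ`. -/
def cube (y : Fin n → ℝ) (δ : ℝ) : Set (EuclideanSpace ℝ (Fin n)) :=
  {x | ∀ i, |x i - y i| ≤ δ}

theorem ediam_cube_le (y : Fin n → ℝ) {δ : ℝ} (hδ : 0 ≤ δ) :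
    ediam (cube y δ) ≤ ENNReal.ofReal (2 * n * δ) := by
  refine ediam_le_of_forall_dist_le fun x hx z hz => ?_
  rw [EuclideanSpace.dist_eq]
  apply Real.sqrt_le_iff.2 ⟨by positivity, ?_⟩
  have h1 : ∀ i ∈ Finset.univ, dist (x i) (z i) ^ 2 ≤ (2 * δ) ^ 2 := by
    intro i _
    have h2 := dist_triangle_right (x i) (z i) (y i)
    rw [Real.dist_eq, Real.dist_eq, Real.dist_eq] at h2
    rw [Real.dist_eq]
    have := hx i
    have := hz i
    gcongr
    linarith
  refine (Finset.sum_le_sum h1).trans ?_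
  rw [Finset.sum_const, Finset.card_univ, Fintype.card_fin, nsmul_eq_mul]
  have h3 : (n : ℝ) ≤ n ^ 2 := by exact_mod_cast Nat.le_self_pow two_ne_zero n
  have h4 := mul_le_mul_of_nonneg_right h3 (sq_nonneg (2 * δ))
  linarith

/-- The number of centres used in the coordinate `i` when the points with `|x i| ≤ K` for all `i`
and `x j` within `δ` of a fraction with denominator `B` are covered by cubes. -/
noncomputable def centreCount (j : Fin n) (K B : ℕ) (δ : ℝ) (i : Fin n) : ℕ :=
  if i = j then (2 * K + 2) * B + 1 else ⌊2 * K / δ⌋₊ + 1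

/-- The centres of the cubes. -/
noncomputable def centre (j : Fin n) (K B : ℕ) (δ : ℝ) (c : Fin n → ℕ) (i : Fin n) : ℝ :=
  if i = j then c i / B - (K + 1) else c i * δ - K

theorem exists_mem_cube {j : Fin n} {K B : ℕ} {δ : ℝ} (hB : 0 < B) (hδ : 0 < δ) (hδ1 : δ ≤ 1)
    {x : EuclideanSpace ℝ (Fin n)} (hx : ∀ i, |x i| ≤ K) {p : ℤ} (hp : |x j - p / B| ≤ δ) :
    ∃ c ∈ Fintype.piFinset fun i => Finset.range (centreCount j K B δ i),
      x ∈ cube (centre j K B δ c) δ := by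
  have hB' : (0 : ℝ) < B := by exact_mod_cast hB
  have hj := abs_le.1 (hx j)
  have hp' := abs_le.1 hp
  have hlow : (-(K + 1) * B : ℝ) ≤ p := by
    rw [← le_div_iff₀ hB']
    linarith
  have hup : (p : ℝ) ≤ (K + 1) * B := by
    rw [← div_le_iff₀ hB']
    linarith
  have hlow' : 0 ≤ p + (K + 1) * B := by
    have : (0 : ℝ) ≤ ((p + (K + 1) * B : ℤ) : ℝ) := by
      push_cast
      linarith
    exact_mod_cast this
  obtain ⟨q, hq⟩ := Int.eq_ofNat_of_zero_le hlow'
  have hqR : (q : ℝ) = p + (K + 1) * B := by exact_mod_cast hq.symm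
  refine ⟨fun i => if i = j then q else ⌊(x i + K) / δ⌋₊, ?_, ?_⟩
  · rw [Fintype.mem_piFinset]
    intro i
    rw [Finset.mem_range]
    by_cases hi : i = j
    · simp only [hi, centreCount, if_true]
      have : (q : ℝ) ≤ (2 * K + 2) * B := by linarith
      exact Nat.lt_succ_of_le (by exact_mod_cast this)
    · simp only [hi, centreCount, if_false]
      apply Nat.lt_succ_of_le
      apply Nat.floor_mono
      have := abs_le.1 (hx i)
      gcongr
      linarith
  · intro i
    by_cases hi : i = j
    · subst hi
      simp only [centre, if_true, hqR]
      rw [add_div, mul_div_cancel_right₀ _ hB'.ne', add_sub_cancel_right]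
      exact hp
    · simp only [centre, hi, if_false]
      have h0 : 0 ≤ (x i + K) / δ := by
        have := abs_le.1 (hx i)
        apply div_nonneg _ hδ.le
        linarith
      have h1 := Nat.floor_le h0
      have h2 := (Nat.lt_floor_add_one ((x i + K) / δ)).le
      rw [le_div_iff₀ hδ] at h1
      rw [div_le_iff₀ hδ] at h2
      rw [abs_le]
      constructor <;> linarith

theorem card_centres_le {j : Fin n} {K B : ℕ} {δ : ℝ} (hB : 0 < B) (hδ : 0 < δ) (hδ1 : δ ≤ 1) :
    ((Fintype.piFinset fun i => Finset.range (centreCount j K B δ i)).card : ℝ) ≤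
      (2 * K + 3) ^ n * (B * (δ⁻¹) ^ (n - 1)) := by
  have hB' : (1 : ℝ) ≤ B := by exact_mod_cast hB
  have hδ' : 1 ≤ δ⁻¹ := (one_le_inv₀ hδ).2 hδ1
  rw [Fintype.card_piFinset]
  simp only [Finset.card_range]
  push_cast
  have hbound : ∀ i, (centreCount j K B δ i : ℝ) ≤ (2 * K + 3) * (if i = j then (B : ℝ) else δ⁻¹) := by
    intro i
    have hK : (0 : ℝ) ≤ K := by positivity
    by_cases hi : i = j
    · simp only [centreCount, hi, if_true]
      push_cast
      linarith
    · simp only [centreCount, hi, if_false]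
      push_cast
      have := Nat.floor_le (show 0 ≤ 2 * K / δ by positivity)
      rw [div_eq_mul_inv] at this ⊢
      nlinarith
  refine (Finset.prod_le_prod (fun i _ => by positivity) fun i _ => hbound i).trans (le_of_eq ?_)
  rw [Finset.prod_mul_distrib, Finset.prod_const, Finset.card_univ, Fintype.card_fin,
    ← Finset.mul_prod_erase _ _ (Finset.mem_univ j), if_pos rfl,
    Finset.prod_congr rfl fun i hi => if_neg (Finset.ne_of_mem_erase hi), Finset.prod_const,
    Finset.card_erase_of_mem (Finset.mem_univ j), Finset.card_univ, Fintype.card_fin]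

theorem tsum_ediam_cube_le {j : Fin n} {K B : ℕ} {δ s : ℝ} (hB : 0 < B) (hδ : 0 < δ)
    (hδ1 : δ ≤ 1) (hs : 0 ≤ s) :
    ∑' c : {c // c ∈ Fintype.piFinset fun i => Finset.range (centreCount j K B δ i)},
      ediam (cube (centre j K B δ c) δ) ^ s ≤
    ENNReal.ofReal ((2 * K + 3) ^ n * (2 * n) ^ s * (B * δ ^ (s - (n - 1 : ℕ)))) := by
  calc ∑' c : {c // c ∈ Fintype.piFinset fun i => Finset.range (centreCount j K B δ i)},
      ediam (cube (centre j K B δ c) δ) ^ s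
      ≤ ∑' c : {c // c ∈ Fintype.piFinset fun i => Finset.range (centreCount j K B δ i)},
        ENNReal.ofReal ((2 * n * δ) ^ s) := by
        refine ENNReal.tsum_le_tsum fun c => ?_
        rw [← ENNReal.ofReal_rpow_of_nonneg (by positivity) hs]
        exact ENNReal.rpow_le_rpow (ediam_cube_le _ hδ.le) hs
    _ ≤ _ := by
        rw [tsum_fintype, Finset.sum_const, Finset.card_univ, Fintype.card_coe, nsmul_eq_mul,
          ← ENNReal.ofReal_natCast, ← ENNReal.ofReal_mul (by positivity)]
        apply ENNReal.ofReal_le_ofReal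
        refine (mul_le_mul_of_nonneg_right (card_centres_le hB hδ hδ1) (by positivity)).trans
          (le_of_eq ?_)
        rw [Real.mul_rpow (by positivity) hδ.le, Real.rpow_sub hδ, Real.rpow_natCast, inv_pow]
        ring

/-- For each `N₀`, the cubes of all levels `N ≥ N₀` cover the set. Level `N` contributes at most a
constant times `ρ ^ N` to the `s`-dimensional sum, so these sums are tails of a convergent geometric
series. -/
theorem dimH_bounded_productSet_le {b : ℕ} (hb : 2 ≤ b) {lam : Fin n → ℝ≥0∞} {j : Fin n}
    {ν s : ℝ≥0} (hν : 0 < ν) (hνj : (ν : ℝ≥0∞) < lam j) (hs : ((n - 1 : ℕ) : ℝ) + (ν : ℝ)⁻¹ < s)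
    (K : ℕ) : dimH {x ∈ productSet b lam | ∀ i, |x i| ≤ K} ≤ s := by
  have hb1 : (1 : ℝ) < b := by exact_mod_cast hb
  have hb0 : (0 : ℝ) < b := by linarith
  have hν' : (0 : ℝ) < ν := hν
  have hs0 : (0 : ℝ) ≤ s := s.2
  set δ : ℕ → ℝ := fun N => ((b : ℝ) ^ N) ^ (-(ν : ℝ)) with hδ
  have hδ0 : ∀ N, 0 < δ N := fun N => by positivity
  have hδ1 : ∀ N, δ N ≤ 1 := fun N => pow_rpow_neg_le_one (by omega) N ν
  set ρ : ℝ := (b : ℝ) ^ (1 - (ν : ℝ) * (s - (n - 1 : ℕ))) with hρ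
  have hρ0 : 0 < ρ := by positivity
  have hρ1 : ρ < 1 := by
    apply Real.rpow_lt_one_of_one_lt_of_neg hb1
    have : (ν : ℝ) * (ν : ℝ)⁻¹ < ν * (s - (n - 1 : ℕ)) := by
      gcongr
      linarith
    rw [mul_inv_cancel₀ hν'.ne'] at this
    linarith
  have hterm : ∀ N : ℕ, ((b ^ N : ℕ) : ℝ) * δ N ^ ((s : ℝ) - (n - 1 : ℕ)) = ρ ^ N := by
    intro N
    rw [hδ, hρ]
    push_cast
    rw [← Real.rpow_natCast, ← Real.rpow_mul hb0.le, ← Real.rpow_mul hb0.le, ← Real.rpow_add hb0,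
      ← Real.rpow_natCast, ← Real.rpow_mul hb0.le]
    congr 1
    ring
  have hδanti : Antitone δ := by
    intro N N' h
    apply Real.rpow_le_rpow_of_nonpos (by positivity) _ (by simp)
    exact pow_le_pow_right₀ hb1.le h
  have hδtend : Tendsto δ atTop (𝓝 0) :=
    (tendsto_rpow_neg_atTop hν').comp (tendsto_pow_atTop_atTop_of_one_lt hb1)
  set C : ℝ := (2 * K + 3) ^ n * (2 * n) ^ (s : ℝ) with hC
  set r : ℕ → ℝ≥0∞ := fun N => ENNReal.ofReal (2 * n * δ N) with hr
  have hrtend : Tendsto r atTop (𝓝 0) := by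
    rw [← ENNReal.ofReal_zero]
    apply ENNReal.tendsto_ofReal
    simpa using hδtend.const_mul (2 * n : ℝ)
  set T : ∀ N₀ : ℕ, (Σ k : ℕ, {c // c ∈ Fintype.piFinset fun i =>
      Finset.range (centreCount j K (b ^ (N₀ + k)) (δ (N₀ + k)) i)}) →
      Set (EuclideanSpace ℝ (Fin n)) := fun N₀ a =>
    cube (centre j K (b ^ (N₀ + a.1)) (δ (N₀ + a.1)) a.2) (δ (N₀ + a.1)) with hT
  have hle := Measure.hausdorffMeasure_le_liminf_tsum (s : ℝ)
    {x ∈ productSet b lam | ∀ i, |x i| ≤ K} r hrtend T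
    (Eventually.of_forall fun N₀ a => by
      refine (ediam_cube_le _ (hδ0 _).le).trans (ENNReal.ofReal_le_ofReal ?_)
      have := hδanti (Nat.le_add_right N₀ a.1)
      gcongr)
    (Eventually.of_forall fun N₀ x hx => by
      obtain ⟨hx, hxK⟩ := hx
      obtain ⟨N, hN, p, hp⟩ := exists_approx_of_lt_theta (b := b) (by omega)
        (hνj.trans_eq (hx j).symm) N₀
      obtain ⟨k, rfl⟩ := Nat.exists_eq_add_of_le hN
      obtain ⟨c, hc, hxc⟩ := exists_mem_cube (B := b ^ (N₀ + k)) (by positivity) (hδ0 (N₀ + k))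
        (hδ1 _) hxK (p := p) (by push_cast; exact hp)
      exact Set.mem_iUnion.2 ⟨⟨k, c, hc⟩, hxc⟩)
  have hsum : ∀ N₀ : ℕ, ∑' a, ediam (T N₀ a) ^ (s : ℝ) ≤
      ENNReal.ofReal (C * ρ ^ N₀) * ∑' k : ℕ, ENNReal.ofReal (ρ ^ k) := by
    intro N₀
    rw [ENNReal.tsum_sigma', ← ENNReal.tsum_mul_left]
    refine ENNReal.tsum_le_tsum fun k => ?_
    refine (tsum_ediam_cube_le (by positivity) (hδ0 _) (hδ1 _) hs0).trans (le_of_eq ?_)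
    rw [hterm, ← ENNReal.ofReal_mul (by positivity), pow_add, hC, mul_assoc _ (ρ ^ N₀)]
  have hgeom : ∑' k : ℕ, ENNReal.ofReal (ρ ^ k) ≠ ∞ := by
    rw [← ENNReal.ofReal_tsum_of_nonneg (fun k => by positivity)
      (summable_geometric_of_lt_one hρ0.le hρ1)]
    exact ENNReal.ofReal_ne_top
  have htend : Tendsto (fun N₀ : ℕ => ENNReal.ofReal (C * ρ ^ N₀) *
      ∑' k : ℕ, ENNReal.ofReal (ρ ^ k)) atTop (𝓝 0) := by
    rw [← zero_mul (∑' k : ℕ, ENNReal.ofReal (ρ ^ k))]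
    refine ENNReal.Tendsto.mul_const ?_ (Or.inr hgeom)
    rw [← ENNReal.ofReal_zero]
    apply ENNReal.tendsto_ofReal
    simpa using (tendsto_pow_atTop_nhds_zero_of_lt_one hρ0.le hρ1).const_mul C
  have hlim := tendsto_of_tendsto_of_tendsto_of_le_of_le tendsto_const_nhds htend
    (fun N₀ => zero_le) hsum
  rw [hlim.liminf_eq] at hle
  exact dimH_le_of_hausdorffMeasure_ne_top (hle.trans_lt ENNReal.zero_lt_top).ne

theorem dimH_productSet_le {b : ℕ} (hb : 2 ≤ b) (lam : Fin n → ℝ≥0∞) (j : Fin n) :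
    dimH (productSet b lam) ≤ ((n - 1 : ℕ) : ℝ≥0∞) + (lam j)⁻¹ := by
  refine le_of_forall_gt_imp_ge_of_dense fun a ha => ?_
  obtain ⟨s, hs, hsa⟩ := ENNReal.lt_iff_exists_nnreal_btwn.1 ha
  refine le_trans ?_ hsa.le
  have h1 : (lam j)⁻¹ < (s : ℝ≥0∞) - (n - 1 : ℕ) := by
    rw [add_comm] at hs
    exact lt_tsub_iff_right.2 hs
  -- This `ν` satisfies `1 / λ_j < 1 / ν < s - (n - 1)`.
  obtain ⟨ν, hν1, hν2⟩ := ENNReal.lt_iff_exists_nnreal_btwn.1 (ENNReal.inv_lt_iff_inv_lt.1 h1)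
  have hν0 : 0 < ν := by exact_mod_cast zero_le.trans_lt hν1
  have h2 : ((n - 1 : ℕ) : ℝ) + (ν : ℝ)⁻¹ < s := by
    have h3 := lt_tsub_iff_right.1 (ENNReal.inv_lt_iff_inv_lt.1 hν1)
    rw [← ENNReal.coe_inv hν0.ne'] at h3
    have h4 : ν⁻¹ + ((n - 1 : ℕ) : ℝ≥0) < s := by exact_mod_cast h3
    rw [add_comm]
    exact_mod_cast h4
  have hcover : productSet b lam = ⋃ K : ℕ, {x ∈ productSet b lam | ∀ i, |x i| ≤ K} := by
    ext x
    simp only [Set.mem_iUnion, Set.mem_ofPred_eq, exists_and_left, iff_self_and]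
    intro _
    obtain ⟨K, hK⟩ := exists_nat_ge (∑ i, |x i|)
    exact ⟨K, fun i => (Finset.single_le_sum (f := fun i => |x i|) (fun i _ => abs_nonneg _)
      (Finset.mem_univ i)).trans hK⟩
  rw [hcover, dimH_iUnion]
  exact iSup_le fun K => dimH_bounded_productSet_le hb hν0 hν2 h2 K

theorem dimH_productSet_le_iSup [NeZero n] {b : ℕ} (hb : 2 ≤ b) (lam : Fin n → ℝ≥0∞) :
    dimH (productSet b lam) ≤ ((n - 1 : ℕ) : ℝ≥0∞) + (⨆ i, lam i)⁻¹ := by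
  have : Nonempty (Fin n) := ⟨0⟩
  obtain ⟨j, hj⟩ := exists_eq_ciSup_of_finite (f := lam)
  rw [← hj]
  exact dimH_productSet_le hb lam j

/-- The case `n = 1` of the covering bound, transported from `EuclideanSpace ℝ (Fin 1)` to `ℝ` by
the coordinate projection. -/
theorem dimH_levelSet_le {b : ℕ} (hb : 2 ≤ b) (l : ℝ≥0∞) : dimH (levelSet b l) ≤ l⁻¹ := by
  have hlip : LipschitzWith 1 fun x : EuclideanSpace ℝ (Fin 1) => x 0 :=
    LipschitzWith.of_dist_le_mul fun x y => by
      simpa [Real.dist_eq, dist_eq_norm] using PiLp.norm_apply_le (x - y) 0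
  have himage : levelSet b l ⊆
      (fun x : EuclideanSpace ℝ (Fin 1) => x 0) '' productSet b fun _ => l :=
    fun ξ hξ => ⟨WithLp.toLp 2 fun _ => ξ, fun _ => hξ, rfl⟩
  refine (dimH_mono himage).trans ((hlip.dimH_image_le _).trans ?_)
  simpa using dimH_productSet_le hb (fun _ : Fin 1 => l) 0

theorem tendsto_inv_iSup_maxToInfinity (n : ℕ) :
    Tendsto (fun lam : Fin n → ℝ≥0∞ => (⨆ i, lam i)⁻¹) (maxToInfinity n) (𝓝 0) := by
  rw [← ENNReal.inv_top]
  exact ((continuous_inv.tendsto _).comp tendsto_comap).mono_left inf_le_left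

theorem eventually_one_le_maxToInfinity (n : ℕ) :
    ∀ᶠ lam in maxToInfinity n, ∀ i, 1 ≤ lam i :=
  Filter.mem_inf_of_right (mem_principal_self _)

end

end PowerApprox

/-! ### Assembly of the three statements -/

theorem mainTheorem4 (n : ℕ) (hn : 1 ≤ n) :
    (∀ b : ℕ, 2 ≤ b → ∀ lam : Fin n → ℝ≥0∞, (∀ i, 1 ≤ lam i) →
      dimH (PowerApprox.productSet b lam) ≤ ((n - 1 : ℕ) : ℝ≥0∞) + (⨆ i, lam i)⁻¹ ∧
      max ((n - 1 : ℕ) : ℝ≥0∞) (∑ i, (lam i)⁻¹) ≤ dimH (PowerApprox.productSet b lam)) ∧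
    (2 ≤ n → ∃ L : ℝ≥0, ∀ b : ℕ, 2 ≤ b → ∀ lam : Fin n → ℝ≥0∞, (∀ i, 1 ≤ lam i) →
      (∀ i, (L : ℝ≥0∞) ≤ lam i) →
      ∑ i, dimH (PowerApprox.levelSet b (lam i)) < dimH (PowerApprox.productSet b lam)) ∧
    (∀ b : ℕ, 2 ≤ b →
      Filter.Tendsto (fun lam : Fin n → ℝ≥0∞ => dimH (PowerApprox.productSet b lam))
        (PowerApprox.maxToInfinity n) (𝓝 ((n - 1 : ℕ) : ℝ≥0∞)) ∧
      Filter.Tendsto (fun lam : Fin n → ℝ≥0∞ => PowerApprox.dimP (PowerApprox.productSet b lam))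
        (PowerApprox.maxToInfinity n) (𝓝 (n : ℝ≥0∞))) := by
  have : NeZero n := ⟨by omega⟩
  refine ⟨fun b hb lam hlam => ⟨PowerApprox.dimH_productSet_le_iSup hb lam,
    max_le (PowerApprox.pred_le_dimH_productSet hb hlam)
      (PowerApprox.sum_inv_le_dimH_productSet hb hlam)⟩, fun hn2 => ⟨3, ?_⟩, fun b hb => ⟨?_, ?_⟩⟩
  · intro b hb lam hlam hL
    refine lt_of_lt_of_le ?_ (PowerApprox.pred_le_dimH_productSet hb hlam)
    have h1 : ∀ i ∈ Finset.univ, dimH (PowerApprox.levelSet b (lam i)) ≤ ((3⁻¹ : ℝ≥0) : ℝ≥0∞) :=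
      fun i _ => (PowerApprox.dimH_levelSet_le hb _).trans (by
        rw [ENNReal.coe_inv (by norm_num)]
        exact ENNReal.inv_le_inv.2 (hL i))
    refine (Finset.sum_le_sum h1).trans_lt ?_
    rw [Finset.sum_const, Finset.card_univ, Fintype.card_fin, nsmul_eq_mul]
    -- With `L = 3`, the inequality `n / 3 < n - 1` holds exactly when `n > 3 / 2`, hence for all `n
    -- ≥ 2`.
    have h2 : (n : ℝ≥0) * 3⁻¹ < (n - 1 : ℕ) := by
      rw [← div_eq_mul_inv, div_lt_iff₀ (by norm_num)]
      exact_mod_cast (by omega : n < (n - 1) * 3)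
    exact_mod_cast h2
  · have hup : Filter.Tendsto (fun lam : Fin n → ℝ≥0∞ => ((n - 1 : ℕ) : ℝ≥0∞) + (⨆ i, lam i)⁻¹)
        (PowerApprox.maxToInfinity n) (𝓝 ((n - 1 : ℕ) : ℝ≥0∞)) := by
      simpa using (PowerApprox.tendsto_inv_iSup_maxToInfinity n).const_add ((n - 1 : ℕ) : ℝ≥0∞)
    refine tendsto_of_tendsto_of_tendsto_of_le_of_le' tendsto_const_nhds hup ?_
      (Filter.Eventually.of_forall fun lam => PowerApprox.dimH_productSet_le_iSup hb lam)
    filter_upwards [PowerApprox.eventually_one_le_maxToInfinity n] with lam hlam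
    exact PowerApprox.pred_le_dimH_productSet hb hlam
  · refine Filter.Tendsto.congr' ?_ tendsto_const_nhds
    filter_upwards [PowerApprox.eventually_one_le_maxToInfinity n] with lam hlam
    exact (PowerApprox.dimP_productSet hb hlam).symm
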